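/- Let $n\ge 3$ and let $C=K_n+_{\cdot}K_3$ be the graph of order $n+2$ consisting of a complete graph $K_n$ and a triangle with exactly one vertex in common. Let $\mathcal G_C$ be the class of countable graphs with no subgraph (induced or not) isomorphic to $C$. Let $\mathcal E_C$ be the class of existentially complete members of $\mathcal G_C$, that is, of those $G\in\mathcal G_C$ such that, whenever $G$ is an induced subgraph of some $H\in\mathcal G_C$, every existential first-order statement in the language of graphs with parameters in $G$ that is true in $H$ is true in $G$. Let $T^*_C$ be the first-order theory of $\mathcal E_C$, i.e. the set of sentences true in all graphs in $\mathcal E_C$. For $G\in\mathcal E_C$ and $A\subseteq V(G)$, let $\mathrm{acl}(A)$ be the set of vertices $b$ for which there is an existential formula $\varphi(x,\bar a)$ with parameters $\bar a$ in $A$ that has only finitely many solutions $x$ in $G$, one of which is $b$. Call a finite set $B\subseteq V(G)$ special if it induces a complete graph and either $|B|=n$ and no set $B'\ne B$ of $n$ vertices that induces a complete graph meets $B$, or $|B|=n-1$ and at least two vertices of $G$ are adjacent to all vertices of $B$. For $a\in V(G)$, let $a^*$ be the union of all special sets $B$ such that $\{a\}\cup B$ induces a complete graph. Then: 1. For every $G\in\mathcal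 E_C$ and every $A\subseteq V(G)$, $A=\mathrm{acl}(A)$ if and only if $a^*\subseteq A$ for every $a\in A$. 2. For every $G\in\mathcal E_C$ and every $a\in V(G)$, $|\{a\}\cup a^*|\le n+1$. 3. For every $G\in\mathcal E_C$ and every $A\subseteq V(G)$, $|\mathrm{acl}(A)|\le (n+1)|A|$. 4. $T^*_C$ is $\aleph_0$-categorical, i.e. it has exactly one countable model up to isomorphism. 5. There is a universal graph in $\mathcal G_C$, i.e. a graph in $\mathcal G_C$ that contains every graph in $\mathcal G_C$ as an induced subgraph, up to isomorphism. -/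

import Mathlib

open FirstOrder

universe u v

namespace UniversalGraphs

/-- The graph `K_n +· K_3`, for `n ≥ 1`, on the vertices `0, …, n + 1`: a complete graph on
`{0, …, n - 1}` and a triangle on `{n - 1, n, n + 1}`, with exactly the vertex `n - 1` in
common. -/
def cliqueWithTriangle (n : ℕ) : SimpleGraph (Fin (n + 2)) where
  Adj i j := i ≠ j ∧ ((i.val < n ∧ j.val < n) ∨ (n ≤ i.val + 1 ∧ n ≤ j.val + 1))
  symm := ⟨fun _ _ h => ⟨h.1.symm, h.2.imp And.symm And.symm⟩⟩
  loopless := ⟨fun _ h => h.1 rfl⟩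

section Classes

variable {W : Type v}

/-- `G` satisfies the first-order formula `φ` of the language of graphs under the
assignment `x`. -/
def Realizes {V : Type u} (G : SimpleGraph V) {α : Type v} (φ : Language.graph.Formula α)
    (x : α → V) : Prop :=
  @Language.Formula.Realize Language.graph V G.structure α φ x

/-- The class `𝒢_C`: countable graphs with no subgraph (induced or not) isomorphic to `C`. -/
def IsCountableFree (C : SimpleGraph W) {V : Type u} (G : SimpleGraph V) : Prop :=
  Countable V ∧ C.Free G

/-- `G` is existentially complete in `H`, where `e` identifies `G` with an induced subgraph
of `H`: every existential statement with parameters in `G` that is true in `H` is true in `G`. -/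
def IsExistentiallyCompleteIn {V V' : Type u} (G : SimpleGraph V) (H : SimpleGraph V')
    (e : G ↪g H) : Prop :=
  ∀ (m : ℕ) (φ : Language.graph.Formula (Fin m)) (a : Fin m → V),
    φ.IsExistential → Realizes H φ (fun i => e (a i)) → Realizes G φ a

/-- The class `ℰ_C`: graphs in `𝒢_C` that are existentially complete in every graph of `𝒢_C`
that contains them as an induced subgraph. -/
def IsExistentiallyComplete (C : SimpleGraph W) {V : Type u} (G : SimpleGraph V) : Prop :=
  IsCountableFree C G ∧
    ∀ (V' : Type u) (H : SimpleGraph V') (e : G ↪g H),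
      IsCountableFree C H → IsExistentiallyCompleteIn G H e

/-- `T*_C`, the first-order theory of the class `ℰ_C`. -/
def theoryOfExistentiallyComplete (C : SimpleGraph W) : Language.graph.Theory :=
  {φ | ∀ (V : Type u) (G : SimpleGraph V), IsExistentiallyComplete C G →
    @Language.Sentence.Realize Language.graph V G.structure φ}

/-- `T` has exactly one countable model up to isomorphism. -/
def IsAleph0Categorical (T : Language.graph.Theory) : Prop :=
  (∃ M : T.ModelType, Countable (M : Type u)) ∧
    ∀ M N : T.ModelType, Countable (M : Type u) → Countable (N : Type u) →
      Nonempty ((M : Type u) ≃[Language.graph] (N : Type u))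

/-- `U` is universal for `𝒢_C`: it belongs to `𝒢_C`, and every graph in `𝒢_C` is isomorphic to
an induced subgraph of `U`. -/
def IsUniversalFor (C : SimpleGraph W) {V : Type u} (U : SimpleGraph V) : Prop :=
  IsCountableFree C U ∧
    ∀ (V' : Type u) (H : SimpleGraph V'), IsCountableFree C H → Nonempty (H ↪g U)

end Classes

section Closure

variable {V : Type u} (G : SimpleGraph V)

/-- The algebraic closure of `A` in `G`: all `b` that satisfy some existential formula
`φ(x, a₁, …, a_m)` with parameters in `A` that has only finitely many solutions `x` in `G`. -/
def acl (A : Set V) : Set V :=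
  {b | ∃ (m : ℕ) (φ : Language.graph.Formula (Fin (m + 1))) (a : Fin m → V),
    φ.IsExistential ∧ (∀ i, a i ∈ A) ∧
    {x : V | Realizes G φ (Fin.cons x a : Fin (m + 1) → V)}.Finite ∧
    Realizes G φ (Fin.cons b a : Fin (m + 1) → V)}

/-- A finite clique `A` is special (relative to `n`) if either `|A| = n` and no other clique of
order `n` meets `A`, or `|A| = n - 1` and at least two vertices are adjacent to all of `A`. -/
def IsSpecial (n : ℕ) (A : Finset V) : Prop :=
  G.IsClique (A : Set V) ∧
    ((A.card = n ∧
        ¬ ∃ B : Finset V, B.card = n ∧ B ≠ A ∧ (∃ x, x ∈ B ∧ x ∈ A) ∧ G.IsClique (B : Set V)) ∨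
      (A.card + 1 = n ∧
        ∃ x y : V, x ≠ y ∧ (∀ v ∈ A, G.Adj x v) ∧ (∀ v ∈ A, G.Adj y v)))

/-- `a*`: the union of the special sets `B` such that `{a} ∪ B` is a clique. -/
def star (n : ℕ) (a : V) : Set V :=
  {b | ∃ B : Finset V, IsSpecial G n B ∧ G.IsClique (insert a (B : Set V)) ∧ b ∈ B}

end Closure

end UniversalGraphs

open UniversalGraphs

/-!
For `n ≥ 3`, two distinct `n`-cliques of a `K_n +· K_3`-free graph that meet share `n - 1` vertices.
So every component of the graph whose vertices are the `n`-cliques and whose edges join cliques that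
meet is a single clique, a sunflower around an `(n - 1)`-clique, or a set of cliques inside one
`K_{n+1}`. It follows that `{a} ∪ a*` has at most `n + 1` elements and that `b ∈ a*` implies
`b* ⊆ a*`, so the closure operation generated by `a ↦ a*` is unary and locally finite.

Call a set closed if it contains `a*` for each of its elements `a`. The free amalgam of two
`K_n +· K_3`-free graphs over a partial isomorphism between closed sets that preserves the special
`(n - 1)`-cliques is again `K_n +· K_3`-free. Amalgamating a graph with itself over a closed set
yields arbitrarily many solutions of any existential formula satisfied outside the set, so closed
sets are algebraically closed. By an ultraproduct argument, every embedding of a sufficiently large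
finite part of an existentially complete graph restricts, on a given finite closed set, to a partial
isomorphism of this kind; hence closed finite partial isomorphisms between existentially complete
graphs can be extended back and forth. Consequently the existentially complete graph is unique, it
contains every graph of the class, and it realizes finitely many types of `k`-tuples for each `k`;
the Ryll-Nardzewski theorem finishes.
-/

namespace UniversalGraphs

/-! ### Patterns of tuples and existential formulas -/

section Patterns

variable {V W ι κ : Type*} {G : SimpleGraph V} {H : SimpleGraph W} {t : ι → V} {s : ι → W}

/-- `h` restricts to an isomorphism from the subgraph of `H` induced on `S` to an induced
subgraph of `G`. -/
def IsEmbeddingOn (H : SimpleGraph W) (G : SimpleGraph V) (S : Set W) (h : W → V) : Prop :=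
  Set.InjOn h S ∧ ∀ x ∈ S, ∀ y ∈ S, G.Adj (h x) (h y) ↔ H.Adj x y

lemma IsEmbeddingOn.mono {S T : Set W} {h : W → V} (hh : IsEmbeddingOn H G T h) (hST : S ⊆ T) :
    IsEmbeddingOn H G S h :=
  ⟨hh.1.mono hST, fun x hx y hy => hh.2 x (hST hx) y (hST hy)⟩

/-- The equalities (first component) and adjacencies (second component) that may hold among the
entries of a tuple. -/
abbrev Pattern (ι : Type*) := (ι → ι → Prop) × (ι → ι → Prop)

/-- The pattern of a tuple of vertices of `G`, that is, its quantifier-free type. -/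
def pattern (G : SimpleGraph V) (t : ι → V) : Pattern ι :=
  (fun i j => t i = t j, fun i j => G.Adj (t i) (t j))

lemma pattern_eq_iff : pattern G t = pattern H s ↔
    ∀ i j, (t i = t j ↔ s i = s j) ∧ (G.Adj (t i) (t j) ↔ H.Adj (s i) (s j)) := by
  simp only [pattern, Prod.mk.injEq, funext_iff, eq_iff_iff, forall_and]

lemma pattern_comp_eq (h : pattern G t = pattern H s) (ρ : κ → ι) :
    pattern G (t ∘ ρ) = pattern H (s ∘ ρ) := by
  rw [pattern_eq_iff] at h ⊢
  exact fun i j => h (ρ i) (ρ j)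

lemma IsEmbeddingOn.pattern_eq {S : Set W} {h : W → V} (hh : IsEmbeddingOn H G S h)
    (hs : ∀ i, s i ∈ S) : pattern G (h ∘ s) = pattern H s :=
  pattern_eq_iff.2 fun i j => ⟨hh.1.eq_iff (hs i) (hs j), hh.2 _ (hs i) _ (hs j)⟩

lemma pattern_embedding (e : G ↪g H) (t : ι → V) : pattern H (e ∘ t) = pattern G t :=
  pattern_eq_iff.2 fun _ _ => ⟨e.injective.eq_iff, e.map_adj_iff⟩

lemma exists_isEmbeddingOn_of_pattern_eq [Nonempty V] (h : pattern G t = pattern H s) :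
    ∃ f : W → V, IsEmbeddingOn H G (Set.range s) f ∧ ∀ i, f (s i) = t i := by
  rw [pattern_eq_iff] at h
  have hst : t.FactorsThrough s := fun i j hij => (h i j).1.2 hij
  refine ⟨Function.extend s t fun _ => Classical.arbitrary V, ⟨?_, ?_⟩, hst.extend_apply _⟩
  · rintro _ ⟨i, rfl⟩ _ ⟨j, rfl⟩ hij
    rw [hst.extend_apply, hst.extend_apply] at hij
    exact (h i j).1.1 hij
  · rintro _ ⟨i, rfl⟩ _ ⟨j, rfl⟩
    rw [hst.extend_apply, hst.extend_apply]
    exact (h i j).2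

end Patterns

section Formulas

open Language BoundedFormula

section Literals

variable {L : Language} {α β : Type*} {n : ℕ}

lemma isQF_iInf [Finite β] (f : β → L.BoundedFormula α n) (hf : ∀ b, (f b).IsQF) :
    (BoundedFormula.iInf f).IsQF := by
  unfold BoundedFormula.iInf
  simp only
  generalize (@Finset.univ β (Fintype.ofFinite β)).toList = l
  induction l with
  | nil => exact IsQF.top
  | cons b l ih => exact (hf b).inf ih

lemma isExistential_exs {φ : L.BoundedFormula α n} (hφ : φ.IsExistential) :
    φ.exs.IsExistential := by
  induction n with
  | zero => exact hφ
  | succ n ih => exact ih hφ.ex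

lemma isExistential_iExs [Finite β] {φ : L.Formula (α ⊕ β)} (hφ : φ.IsQF) :
    (φ.iExs β).IsExistential :=
  isExistential_exs (hφ.relabel _).isExistential

open Classical in
/-- `φ` or its negation, according to the truth value of `c`; used to write down the diagram of a
tuple. -/
noncomputable def literal (c : Prop) (φ : L.Formula α) : L.Formula α :=
  if c then φ else φ.not

lemma isQF_literal {c : Prop} {φ : L.Formula α} (hφ : φ.IsQF) : (literal c φ).IsQF := by
  unfold literal
  split_ifs
  exacts [hφ, hφ.not]

lemma realize_literal {M : Type*} [L.Structure M] {c : Prop} {φ : L.Formula α} {t : α → M} :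
    (literal c φ).Realize t ↔ (φ.Realize t ↔ c) := by
  by_cases hc : c <;> simp [literal, hc, Formula.realize_not]

end Literals

/-- The quantifier-free formula saying that a tuple has the pattern `P`. -/
noncomputable def patternFormula {ι : Type*} [Finite ι] (P : Pattern ι) :
    Language.graph.Formula ι :=
  Formula.iInf fun p : ι × ι =>
    literal (P.1 p.1 p.2) (Term.equal (Term.var p.1) (Term.var p.2)) ⊓
      literal (P.2 p.1 p.2) (Relations.formula₂ Language.adj (Term.var p.1) (Term.var p.2))

lemma isQF_patternFormula {ι : Type*} [Finite ι] (P : Pattern ι) : (patternFormula P).IsQF :=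
  isQF_iInf _ fun _ => (isQF_literal (IsAtomic.equal _ _).isQF).inf
    (isQF_literal (IsAtomic.rel _ _).isQF)

lemma realizes_patternFormula {V : Type u} {ι : Type v} [Finite ι] {G : SimpleGraph V}
    {P : Pattern ι} {t : ι → V} : Realizes G (patternFormula P) t ↔ pattern G t = P := by
  let := G.structure
  have hadj : ∀ i j, Structure.RelMap Language.adj ![t i, t j] ↔ G.Adj (t i) (t j) :=
    fun _ _ => Iff.rfl
  simp only [Realizes, patternFormula, Formula.realize_iInf, Formula.realize_inf, realize_literal,
    Formula.realize_equal, Formula.realize_rel₂, Term.realize_var, hadj, pattern, Prod.ext_iff,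
    funext_iff, eq_iff_iff, Prod.forall, forall_and]

lemma exists_isExistential_realizes_iff {α κ : Type v} [Finite α] [Finite κ]
    (P : Pattern (α ⊕ κ)) :
    ∃ φ : Language.graph.Formula α, φ.IsExistential ∧
      ∀ (V : Type u) (G : SimpleGraph V) (a : α → V),
        Realizes G φ a ↔ ∃ y : κ → V, pattern G (Sum.elim a y) = P := by
  refine ⟨(patternFormula P).iExs κ, isExistential_iExs (isQF_patternFormula P), fun V G a => ?_⟩
  let := G.structure
  simp only [Realizes, Formula.realize_iExs]
  exact exists_congr fun y => realizes_patternFormula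

section Transfer

variable {V W : Type u} {α : Type*} {G : SimpleGraph V} {H : SimpleGraph W} {m : ℕ}

lemma realize_iff_of_pattern_eq {φ : Language.graph.BoundedFormula α m} (hφ : φ.IsQF)
    {v : α → V} {xs : Fin m → V} {w : α → W} {ys : Fin m → W}
    (h : pattern G (Sum.elim v xs) = pattern H (Sum.elim w ys)) :
    @BoundedFormula.Realize _ _ G.structure _ _ φ v xs ↔
      @BoundedFormula.Realize _ _ H.structure _ _ φ w ys := by
  let := G.structure
  let := H.structure
  rw [pattern_eq_iff] at h
  have exists_eq_var : ∀ τ : Language.graph.Term (α ⊕ Fin m), ∃ i, τ = Term.var i := by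
    rintro (i | ⟨f, -⟩)
    exacts [⟨i, rfl⟩, isEmptyElim f]
  induction hφ with
  | falsum => rfl
  | of_isAtomic hatomic =>
    cases hatomic with
    | equal τ₁ τ₂ =>
      obtain ⟨i, rfl⟩ := exists_eq_var τ₁
      obtain ⟨j, rfl⟩ := exists_eq_var τ₂
      simpa only [realize_bdEqual, Term.realize_var] using (h i j).1
    | @rel l R τ =>
      match l, R with
      | 2, .adj =>
        obtain ⟨i, hi⟩ := exists_eq_var (τ 0)
        obtain ⟨j, hj⟩ := exists_eq_var (τ 1)
        change G.Adj ((τ 0).realize _) ((τ 1).realize _) ↔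
          H.Adj ((τ 0).realize _) ((τ 1).realize _)
        simpa only [hi, hj, Term.realize_var] using (h i j).2
  | imp _ _ ih₁ ih₂ => simp only [realize_imp, ih₁, ih₂]

lemma exists_realize_of_pattern_eq {φ : Language.graph.BoundedFormula α m}
    (hφ : φ.IsExistential) {w : α → W} {ys : Fin m → W}
    (hr : @BoundedFormula.Realize _ _ H.structure _ _ φ w ys) :
    ∃ (k : ℕ) (z : Fin k → W), ∀ (V : Type u) (G : SimpleGraph V) (v : α → V) (xs : Fin m → V)
      (y : Fin k → V), pattern G (Sum.elim (Sum.elim v xs) y) =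
          pattern H (Sum.elim (Sum.elim w ys) z) →
        @BoundedFormula.Realize _ _ G.structure _ _ φ v xs := by
  let := H.structure
  induction hφ with
  | of_isQF hqf =>
    exact ⟨0, Fin.elim0, fun V G v xs y h =>
      (realize_iff_of_pattern_eq hqf (pattern_comp_eq h Sum.inl)).2 hr⟩
  | @ex m φ _ ih =>
    obtain ⟨x, hx⟩ := realize_ex.1 hr
    obtain ⟨k, z, hz⟩ := ih hx
    refine ⟨k + 1, Fin.cons x z, fun V G v xs y h => ?_⟩
    let := G.structure
    let ρ : (α ⊕ Fin (m + 1)) ⊕ Fin k → (α ⊕ Fin m) ⊕ Fin (k + 1) :=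
      Sum.elim (Sum.elim (Sum.inl ∘ Sum.inl)
        (Fin.snoc (α := fun _ => _) (Sum.inl ∘ Sum.inr) (Sum.inr 0))) (Sum.inr ∘ Fin.succ)
    have hρ : ∀ (U : Type u) (p : α → U) (q : Fin m → U) (r : Fin (k + 1) → U),
        Sum.elim (Sum.elim p q) r ∘ ρ =
          Sum.elim (Sum.elim p (Fin.snoc (α := fun _ => U) q (r 0))) (Fin.tail r) := by
      intro U p q r
      simp only [ρ, Sum.comp_elim, Fin.comp_snoc]
      rfl
    refine realize_ex.2 ⟨y 0, hz V G v _ (Fin.tail y) ?_⟩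
    have := pattern_comp_eq h ρ
    rwa [hρ, hρ] at this

lemma exists_realizes_of_pattern_eq {ι : Type v} {φ : Language.graph.Formula ι}
    (hφ : φ.IsExistential) {w : ι → W} (hr : Realizes H φ w) :
    ∃ (k : ℕ) (z : Fin k → W), ∀ (V : Type u) (G : SimpleGraph V) (v : ι → V) (y : Fin k → V),
      pattern G (Sum.elim v y) = pattern H (Sum.elim w z) → Realizes G φ v := by
  obtain ⟨k, z, hz⟩ := exists_realize_of_pattern_eq hφ hr
  refine ⟨k, z, fun V G v y h => hz V G v default y ?_⟩
  have hρ : ∀ (U : Type u) (p : ι → U) (r : Fin k → U), Sum.elim p r ∘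
      Sum.elim (Sum.elim Sum.inl Fin.elim0) Sum.inr = Sum.elim (Sum.elim p default) r := by
    intro U p r
    simp only [Sum.comp_elim, Sum.elim_comp_inl, Sum.elim_comp_inr]
    congr
    exact Subsingleton.elim _ _
  have := pattern_comp_eq h (Sum.elim (Sum.elim Sum.inl Fin.elim0) Sum.inr)
  rwa [hρ, hρ] at this

end Transfer

end Formulas

/-! ### Existential completeness and algebraic closure in terms of patterns -/

section Reflection

variable {X : Type v} {C : SimpleGraph X} {V : Type u} {G : SimpleGraph V}

lemma free_of_embedding {V' : Type*} {H : SimpleGraph V'} (e : G ↪g H) (hH : C.Free H) :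
    C.Free G :=
  fun h => hH (h.trans ⟨e.toCopy⟩)

/-- Every configuration of finitely many vertices over finitely many parameters in `G` that occurs
in a graph of `𝒢_C` above `G` already occurs in `G`: the semantic counterpart of existential
completeness. -/
def ReflectsPatterns (C : SimpleGraph X) (G : SimpleGraph V) : Prop :=
  ∀ (V' : Type u) (H : SimpleGraph V') (e : G ↪g H), IsCountableFree C H →
    ∀ (m k : ℕ) (a : Fin m → V) (y : Fin k → V'),
      ∃ y' : Fin k → V, pattern G (Sum.elim a y') = pattern H (Sum.elim (e ∘ a) y)

theorem isExistentiallyComplete_iff :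
    IsExistentiallyComplete C G ↔ IsCountableFree C G ∧ ReflectsPatterns C G := by
  refine and_congr_right fun _ => ⟨fun hG V' H e hH m k a y => ?_,
    fun hG V' H e hH m φ a hφ hr => ?_⟩
  · obtain ⟨φ, hφ, hφ_iff⟩ :=
      exists_isExistential_realizes_iff.{u} (pattern H (Sum.elim (e ∘ a) y))
    exact (hφ_iff V G a).1 (hG V' H e hH m φ a hφ ((hφ_iff V' H (e ∘ a)).2 ⟨y, rfl⟩))
  · obtain ⟨k, z, hz⟩ := exists_realizes_of_pattern_eq hφ hr
    obtain ⟨y', hy'⟩ := hG V' H e hH m k a z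
    exact hz V G a y' hy'

namespace IsExistentiallyComplete

lemma countable (hG : IsExistentiallyComplete C G) : Countable V := hG.1.1

lemma free (hG : IsExistentiallyComplete C G) : C.Free G := hG.1.2

lemma exists_pattern_eq (hG : IsExistentiallyComplete C G) {V' : Type u} {H : SimpleGraph V'}
    (e : G ↪g H) (hH : C.Free H) {ι κ : Type*} [Finite ι] [Finite κ] (a : ι → V) (y : κ → V') :
    ∃ y' : κ → V, pattern G (Sum.elim a y') = pattern H (Sum.elim (e ∘ a) y) := by
  have := hG.countable
  let S : Set V' := Set.range e ∪ Set.range y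
  have hS : Countable S :=
    ((Set.countable_range e).union (Set.finite_range y).countable).to_subtype
  let e' : G ↪g H.induce S :=
    ⟨⟨fun x => ⟨e x, Or.inl ⟨x, rfl⟩⟩, fun _ _ h => e.injective (congrArg Subtype.val h)⟩,
      e.map_rel_iff⟩
  let i : H.induce S ↪g H := SimpleGraph.Embedding.induce S
  obtain ⟨m, ⟨fι⟩⟩ := Finite.exists_equiv_fin ι
  obtain ⟨k, ⟨fκ⟩⟩ := Finite.exists_equiv_fin κ
  obtain ⟨y', hy'⟩ := (isExistentiallyComplete_iff.1 hG).2 S _ e' ⟨hS, free_of_embedding i hH⟩ m k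
    (a ∘ fι.symm) fun j => ⟨y (fκ.symm j), Or.inr ⟨_, rfl⟩⟩
  refine ⟨y' ∘ fκ, ?_⟩
  have := pattern_comp_eq (hy'.trans (pattern_embedding i _).symm) (Sum.map fι fκ)
  convert this using 2 <;> ext (j | j) <;> simp [i]
  rfl

lemma exists_retraction [Nonempty V] (hG : IsExistentiallyComplete C G) {V' : Type u}
    {H : SimpleGraph V'} (e : G ↪g H) (hH : C.Free H) {S : Set V'} (hS : S.Finite) :
    ∃ h : V' → V, IsEmbeddingOn H G S h ∧ ∀ a, e a ∈ S → h (e a) = a := by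
  have : Finite S := hS
  have : Finite (e ⁻¹' S) := hS.preimage e.injective.injOn
  obtain ⟨y', hy'⟩ := hG.exists_pattern_eq e hH (Subtype.val : e ⁻¹' S → V) (Subtype.val : S → V')
  obtain ⟨h, hh, hval⟩ := exists_isEmbeddingOn_of_pattern_eq hy'
  exact ⟨h, hh.mono fun x hx => ⟨Sum.inr ⟨x, hx⟩, rfl⟩, fun a ha => hval (Sum.inl ⟨a, ha⟩)⟩

lemma nonempty [Nontrivial X] (hG : IsExistentiallyComplete C G) : Nonempty V := by
  by_contra hV
  rw [not_nonempty_iff] at hV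
  have hfree : C.Free (⊥ : SimpleGraph PUnit.{u + 1}) := by
    rintro ⟨c⟩
    obtain ⟨x, y, hxy⟩ := exists_pair_ne X
    exact hxy (c.injective (Subsingleton.elim _ _))
  obtain ⟨y', -⟩ := hG.exists_pattern_eq (H := ⊥)
    ⟨⟨isEmptyElim, fun x => isEmptyElim x⟩, fun {x} => isEmptyElim x⟩ hfree
    (isEmptyElim : Empty → V) fun _ : Unit => PUnit.unit
  exact hV.false (y' ())

end IsExistentiallyComplete

end Reflection

section AlgebraicClosure

variable {V : Type u} {G : SimpleGraph V} {A B : Set V} {b : V}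

lemma mem_acl_iff : b ∈ acl G A ↔ ∃ (m k : ℕ) (a : Fin m → V) (y : Fin k → V), (∀ i, a i ∈ A) ∧
    {x | ∃ y' : Fin k → V, pattern G (Sum.elim (Fin.cons x a : Fin (m + 1) → V) y') =
      pattern G (Sum.elim (Fin.cons b a : Fin (m + 1) → V) y)}.Finite := by
  constructor
  · rintro ⟨m, φ, a, hφ, haA, hfin, hr⟩
    obtain ⟨k, y, hy⟩ := exists_realizes_of_pattern_eq hφ hr
    exact ⟨m, k, a, y, haA, hfin.subset fun x ⟨y', hy'⟩ => hy V G _ y' hy'⟩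
  · rintro ⟨m, k, a, y, haA, hfin⟩
    obtain ⟨φ, hφ, hφ_iff⟩ := exists_isExistential_realizes_iff.{u}
      (pattern G (Sum.elim (Fin.cons b a : Fin (m + 1) → V) y))
    exact ⟨m, φ, a, hφ, haA, hfin.subset fun x hx => (hφ_iff V G _).1 hx,
      (hφ_iff V G _).2 ⟨y, rfl⟩⟩

lemma mem_acl_of_finite {S : Set V} (hS : S.Finite)
    (hfin : {x | ∃ h : V → V, IsEmbeddingOn G G S h ∧ (∀ a ∈ S, a ∈ A → h a = a) ∧
      h b = x}.Finite) : b ∈ acl G A := by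
  obtain ⟨k, y, -, hy⟩ := hS.fin_param
  obtain ⟨m, a, -, ha⟩ := (hS.inter_of_left A).fin_param
  refine mem_acl_iff.2 ⟨m, k, a, y, fun i => (ha ▸ Set.mem_range_self i : a i ∈ S ∩ A).2,
    hfin.subset ?_⟩
  rintro x ⟨y', hy'⟩
  have : Nonempty V := ⟨b⟩
  obtain ⟨h, hh, hval⟩ := exists_isEmbeddingOn_of_pattern_eq hy'
  refine ⟨h, hh.mono ?_, fun c hc hcA => ?_, hval (Sum.inl 0)⟩
  · rw [← hy]
    rintro _ ⟨i, rfl⟩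
    exact ⟨Sum.inr i, rfl⟩
  · obtain ⟨i, rfl⟩ : c ∈ Set.range a := ha ▸ ⟨hc, hcA⟩
    exact hval (Sum.inl i.succ)

lemma exists_finite_of_mem_acl (hb : b ∈ acl G A) : ∃ S : Set V, S.Finite ∧ b ∈ S ∧
    {x | ∃ h : V → V, IsEmbeddingOn G G S h ∧ (∀ a ∈ S, a ∈ A → h a = a) ∧ h b = x}.Finite := by
  obtain ⟨m, k, a, y, haA, hfin⟩ := mem_acl_iff.1 hb
  refine ⟨Set.range (Sum.elim (Fin.cons b a : Fin (m + 1) → V) y), Set.finite_range _,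
    ⟨Sum.inl 0, rfl⟩, hfin.subset ?_⟩
  rintro _ ⟨h, hh, hfix, rfl⟩
  refine ⟨h ∘ y, ?_⟩
  rw [← hh.pattern_eq (Set.mem_range_self (f := Sum.elim _ y)), Sum.comp_elim]
  congr 2
  refine funext (Fin.cases rfl fun i => ?_)
  exact (hfix _ ⟨Sum.inl i.succ, rfl⟩ (haA i)).symm

lemma subset_acl : A ⊆ acl G A := fun b hb =>
  mem_acl_of_finite (Set.finite_singleton b)
    ((Set.finite_singleton b).subset fun _ ⟨_, _, hfix, hx⟩ => hx ▸ hfix b rfl hb)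

lemma acl_mono (hAB : A ⊆ B) : acl G A ⊆ acl G B :=
  fun _ ⟨m, φ, a, hφ, haA, h⟩ => ⟨m, φ, a, hφ, fun i => hAB (haA i), h⟩

end AlgebraicClosure

/-! ### Clusters of cliques and the sets `a*` -/

section Cliques

variable {V : Type*} {G : SimpleGraph V} {n : ℕ}

/-- No triangle meets a clique of order `n` in exactly one vertex; for `n ≥ 1` this says that `G`
has no subgraph `K_n +· K_3`. -/
def CliqueTriangleFree (n : ℕ) (G : SimpleGraph V) : Prop :=
  ∀ Q : Finset V, G.IsClique (Q : Set V) → Q.card = n → ∀ v ∈ Q, ∀ x y, G.Adj v x → G.Adj v y →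
    G.Adj x y → x ∈ Q ∨ y ∈ Q

lemma adj_snoc_snoc_of_lt {m : ℕ} {q : Fin (m + 1) → V} (hq : Pairwise fun i j => G.Adj (q i) (q j))
    {x y : V} (hqx : G.Adj (q (Fin.last m)) x) (hqy : G.Adj (q (Fin.last m)) y) (hxy : G.Adj x y)
    {i j : Fin (m + 3)} (hij : i < j) (h : (cliqueWithTriangle (m + 1)).Adj i j) :
    G.Adj (Fin.snoc (α := fun _ => V) (Fin.snoc (α := fun _ => V) q x) y i)
      (Fin.snoc (α := fun _ => V) (Fin.snoc (α := fun _ => V) q x) y j) := by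
  obtain ⟨-, hdisj⟩ := h
  have eq_last : ∀ i : Fin (m + 1), m ≤ i → i = Fin.last m := fun i hi => Fin.ext (by simp; omega)
  induction i using Fin.lastCases with
  | last => exact absurd hij (Fin.le_last j).not_gt
  | cast i =>
    induction j using Fin.lastCases with
    | last =>
      induction i using Fin.lastCases with
      | last => simpa using hxy
      | cast i =>
        obtain rfl := eq_last i (by simp at hdisj; omega)
        simpa using hqy
    | cast j =>
      induction i using Fin.lastCases with
      | last => exact absurd hij (Fin.castSucc_lt_castSucc_iff.not.2 (Fin.le_last j).not_gt)
      | cast i =>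
        induction j using Fin.lastCases with
        | last =>
          obtain rfl := eq_last i (by simp at hdisj; omega)
          simpa using hqx
        | cast j =>
          have hne : i ≠ j := by rintro rfl; exact lt_irrefl _ hij
          simpa using hq hne

lemma isContained_cliqueWithTriangle {m : ℕ} {q : Fin (m + 1) → V}
    (hq : Pairwise fun i j => G.Adj (q i) (q j)) {x y : V} (hx : x ∉ Set.range q)
    (hy : y ∉ Set.range q) (hqx : G.Adj (q (Fin.last m)) x) (hqy : G.Adj (q (Fin.last m)) y)
    (hxy : G.Adj x y) : (cliqueWithTriangle (m + 1)).IsContained G := by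
  let f : Fin (m + 3) → V := Fin.snoc (α := fun _ => V) (Fin.snoc (α := fun _ => V) q x) y
  have hinj : Function.Injective q := fun i j hij => by_contra fun h => (hq h).ne hij
  have hf : Function.Injective f := by
    refine Fin.snoc_injective_iff.2 ⟨Fin.snoc_injective_iff.2 ⟨hinj, hx⟩, ?_⟩
    rintro ⟨i, hi⟩
    induction i using Fin.lastCases with
    | last => exact hxy.ne (by simpa using hi)
    | cast i => exact hy ⟨i, by simpa using hi⟩
  refine ⟨⟨⟨f, fun {i j} h => ?_⟩, hf⟩⟩
  rcases lt_or_gt_of_ne h.1 with hij | hij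
  exacts [adj_snoc_snoc_of_lt hq hqx hqy hxy hij h,
    (adj_snoc_snoc_of_lt hq hqx hqy hxy hij h.symm).symm]

lemma cliqueTriangleFree_of_free (hn : 1 ≤ n) (hG : (cliqueWithTriangle n).Free G) :
    CliqueTriangleFree n G := by
  obtain ⟨m, rfl⟩ : ∃ m, n = m + 1 := ⟨n - 1, by omega⟩
  intro Q hQ hcard v hv x y hvx hvy hxy
  by_contra! hcon
  let e : Fin (m + 1) ≃ Q := (Q.equivFinOfCardEq hcard).symm
  let q : Fin (m + 1) → V := fun i => e (Equiv.swap (Fin.last m) (e.symm ⟨v, hv⟩) i)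
  have hlast : q (Fin.last m) = v := by simp [q]
  have hrange : Set.range q ⊆ Q := by
    rintro _ ⟨i, rfl⟩
    exact (e _).2
  have hinj : Function.Injective q :=
    Subtype.val_injective.comp (e.injective.comp (Equiv.injective _))
  exact hG (isContained_cliqueWithTriangle (q := q)
    (fun i j hij => hQ (hrange ⟨i, rfl⟩) (hrange ⟨j, rfl⟩) (hinj.ne hij))
    (fun h => hcon.1 (hrange h)) (fun h => hcon.2 (hrange h)) (hlast ▸ hvx) (hlast ▸ hvy) hxy)

lemma free_of_cliqueTriangleFree (hn : 1 ≤ n) (hG : CliqueTriangleFree n G) :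
    (cliqueWithTriangle n).Free G := by
  rintro ⟨c⟩
  have hadj : ∀ i j, (cliqueWithTriangle n).Adj i j → G.Adj (c i) (c j) :=
    fun i j hij => c.toHom.map_adj hij
  have hne : ∀ k : ℕ, ∀ hk : k < n + 2, n ≤ k → ∀ i : Fin n,
      c (i.castLE (by omega)) ≠ c ⟨k, hk⟩ := by
    intro k hk hnk i h
    have := congrArg Fin.val (c.injective h)
    simp only [Fin.val_castLE] at this
    omega
  let Q : Finset V :=
    Finset.univ.map ((Fin.castLEEmb (show n ≤ n + 2 by omega)).trans c.toEmbedding)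
  have hQ : G.IsClique (Q : Set V) := by
    simp only [Q, Finset.coe_map, Finset.coe_univ, Set.image_univ]
    rintro _ ⟨i, rfl⟩ _ ⟨j, rfl⟩ hij
    exact hadj _ _ ⟨fun h => hij (congrArg c h), Or.inl ⟨i.2, j.2⟩⟩
  have htriangle : ∀ k l : ℕ, ∀ (hk : k < n + 2) (hl : l < n + 2), n ≤ k + 1 → n ≤ l + 1 →
      k ≠ l → G.Adj (c ⟨k, hk⟩) (c ⟨l, hl⟩) :=
    fun k l hk hl hk' hl' hkl => hadj _ _ ⟨fun h => hkl (congrArg Fin.val h), Or.inr ⟨hk', hl'⟩⟩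
  have hlast : c ⟨n - 1, by omega⟩ ∈ Q :=
    Finset.mem_map.2 ⟨⟨n - 1, by omega⟩, Finset.mem_univ _, rfl⟩
  rcases hG Q hQ (by simp [Q]) _ hlast (c ⟨n, by omega⟩) (c ⟨n + 1, by omega⟩)
    (htriangle _ _ _ _ (by omega) (by omega) (by omega))
    (htriangle _ _ _ _ (by omega) (by omega) (by omega))
    (htriangle _ _ _ _ (by omega) (by omega) (by omega)) with h | h <;>
    obtain ⟨i, -, hi⟩ := Finset.mem_map.1 h
  exacts [hne _ _ le_rfl i hi, hne _ _ (Nat.le_succ n) i hi]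

end Cliques

section Clusters

variable {V : Type*} {G : SimpleGraph V} {n : ℕ}

/-- `Q` is a clique of order `n` that no other such clique meets: the first kind of special set. -/
def IsIsolatedClique (G : SimpleGraph V) (n : ℕ) (Q : Finset V) : Prop :=
  G.IsNClique n Q ∧ ∀ R : Finset V, G.IsNClique n R → ∀ x ∈ R, x ∈ Q → R = Q

/-- `B` is a clique of order `n - 1` contained in at least two cliques of order `n`: the second
kind of special set. -/
def IsKernel (G : SimpleGraph V) (n : ℕ) (B : Finset V) : Prop :=
  G.IsClique (B : Set V) ∧ B.card + 1 = n ∧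
    ∃ x y : V, x ≠ y ∧ (∀ v ∈ B, G.Adj x v) ∧ (∀ v ∈ B, G.Adj y v)

lemma isSpecial_iff {B : Finset V} :
    IsSpecial G n B ↔ IsIsolatedClique G n B ∨ IsKernel G n B := by
  constructor
  · rintro ⟨hB, ⟨hc, h⟩ | ⟨hc, h⟩⟩
    · refine Or.inl ⟨⟨hB, hc⟩, fun R hR x hx hxB => ?_⟩
      by_contra hne
      exact h ⟨R, hR.card_eq, hne, ⟨x, hx, hxB⟩, hR.isClique⟩
    · exact Or.inr ⟨hB, hc, h⟩
  · rintro (⟨hB, h⟩ | ⟨hB, hc, h⟩)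
    · refine ⟨hB.isClique, Or.inl ⟨hB.card_eq, ?_⟩⟩
      rintro ⟨R, hR, hne, ⟨x, hx, hxB⟩, hR'⟩
      exact hne (h R ⟨hR', hR⟩ x hx hxB)
    · exact ⟨hB, Or.inr ⟨hc, h⟩⟩

lemma notMem_of_forall_adj {B : Finset V} {x : V} (h : ∀ v ∈ B, G.Adj x v) : x ∉ B :=
  fun hx => (h x hx).ne rfl

lemma isNClique_insert_of_forall_adj [DecidableEq V] {B : Finset V} {x : V}
    (hB : G.IsClique (B : Set V)) (hc : B.card + 1 = n) (h : ∀ v ∈ B, G.Adj x v) :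
    G.IsNClique n (insert x B) :=
  hc ▸ (⟨hB, rfl⟩ : G.IsNClique B.card B).insert h

lemma IsKernel.exists_isNClique {B : Finset V} {a : V} (hB : IsKernel G n B)
    (ha : G.IsClique (insert a (B : Set V))) : ∃ Q : Finset V, G.IsNClique n Q ∧ a ∈ Q ∧ B ⊆ Q := by
  classical
  obtain ⟨hcl, hc, x, y, -, hx, -⟩ := hB
  by_cases haB : a ∈ B
  · exact ⟨insert x B, isNClique_insert_of_forall_adj hcl hc hx, Finset.mem_insert_of_mem haB,
      Finset.subset_insert _ _⟩
  · refine ⟨insert a B, ⟨by rwa [Finset.coe_insert], ?_⟩, Finset.mem_insert_self _ _,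
      Finset.subset_insert _ _⟩
    rw [Finset.card_insert_of_notMem haB, hc]

lemma IsKernel.isNClique_succ [DecidableEq V] {B : Finset V} {p q : V} (hB : IsKernel G n B)
    (hp : ∀ v ∈ B, G.Adj p v) (hq : ∀ v ∈ B, G.Adj q v) (hpq : G.Adj p q) :
    G.IsNClique (n + 1) (insert p (insert q B)) := by
  refine (isNClique_insert_of_forall_adj hB.1 hB.2.1 hq).insert fun v hv => ?_
  rcases Finset.mem_insert.1 hv with rfl | hv
  exacts [hpq, hp v hv]

lemma IsIsolatedClique.mem_of_isClique_insert {Q : Finset V} {a : V} (hn : 2 ≤ n)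
    (hQ : IsIsolatedClique G n Q) (ha : G.IsClique (insert a (Q : Set V))) : a ∈ Q := by
  classical
  by_contra haQ
  have hP : G.IsNClique (n + 1) (insert a Q) :=
    ⟨by rwa [Finset.coe_insert], by rw [Finset.card_insert_of_notMem haQ, hQ.1.card_eq]⟩
  obtain ⟨u, hu, w, hw, huw⟩ := Finset.one_lt_card.1 (show 1 < Q.card by rw [hQ.1.card_eq]; omega)
  have := hQ.2 _ (hP.erase_of_mem (Finset.mem_insert_of_mem hu)) w
    (Finset.mem_erase.2 ⟨huw.symm, Finset.mem_insert_of_mem hw⟩) hw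
  rw [← this] at hu
  simp at hu

lemma IsIsolatedClique.not_isKernel_subset {Q B : Finset V} (hn : 2 ≤ n)
    (hQ : IsIsolatedClique G n Q) (hB : IsKernel G n B) : ¬ B ⊆ Q := by
  classical
  intro hBQ
  obtain ⟨hcl, hc, x, y, hxy, hx, hy⟩ := hB
  obtain ⟨b, hb⟩ : B.Nonempty := Finset.card_pos.1 (by omega)
  have hext : ∀ z, (∀ v ∈ B, G.Adj z v) → insert z B = Q := fun z hz =>
    hQ.2 _ (isNClique_insert_of_forall_adj hcl hc hz) b (Finset.mem_insert_of_mem hb) (hBQ hb)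
  have hxy' : x ∈ insert y B := by rw [hext y hy, ← hext x hx]; exact Finset.mem_insert_self _ _
  rcases Finset.mem_insert.1 hxy' with h | h
  exacts [hxy h, notMem_of_forall_adj hx h]

lemma IsIsolatedClique.star_eq {Q : Finset V} {a : V} (hn : 2 ≤ n)
    (hQ : IsIsolatedClique G n Q) (ha : a ∈ Q) : star G n a = Q := by
  refine Set.Subset.antisymm ?_ fun b hb =>
    ⟨Q, isSpecial_iff.2 (Or.inl hQ), by rw [Set.insert_eq_of_mem (by exact ha)]; exact hQ.1.1, hb⟩
  rintro b ⟨B, hB, hclq, hb⟩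
  rcases isSpecial_iff.1 hB with hB | hB
  · rw [← hQ.2 B hB.1 a (hB.mem_of_isClique_insert hn hclq) ha]
    exact hb
  · obtain ⟨R, hR, haR, hBR⟩ := hB.exists_isNClique hclq
    rw [hQ.2 R hR a haR ha] at hBR
    exact absurd hBR (hQ.not_isKernel_subset hn hB)

lemma exists_isKernel_of_mem {P : Finset V} {c : V} (hn : 2 ≤ n) (hP : G.IsNClique (n + 1) P)
    (hc : c ∈ P) : ∃ B ⊆ P, c ∈ B ∧ IsKernel G n B := by
  classical
  obtain ⟨u, hu, w, hw, huw⟩ := Finset.one_lt_card.1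
    (show 1 < (P.erase c).card by rw [Finset.card_erase_of_mem hc, hP.card_eq]; omega)
  obtain ⟨huc, huP⟩ := Finset.mem_erase.1 hu
  obtain ⟨hwc, hwP⟩ := Finset.mem_erase.1 hw
  have hadj : ∀ z ∈ P, (z = u ∨ z = w) → ∀ v ∈ (P.erase u).erase w, G.Adj z v := by
    intro z hzP hz v hv
    simp only [Finset.mem_erase] at hv
    exact hP.isClique hzP hv.2.2 (by rintro rfl; exact hz.elim hv.2.1 hv.1)
  have hsub : (P.erase u).erase w ⊆ P := (Finset.erase_subset _ _).trans (Finset.erase_subset _ _)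
  refine ⟨_, hsub, by simp [hc, huc.symm, hwc.symm], hP.isClique.subset (by exact_mod_cast hsub),
    ?_, u, w, huw, hadj u huP (Or.inl rfl), hadj w hwP (Or.inr rfl)⟩
  rw [Finset.card_erase_of_mem (by simp [hwP, huw.symm]), Finset.card_erase_of_mem huP, hP.card_eq]
  omega

namespace CliqueTriangleFree

variable (hG : CliqueTriangleFree n G)
include hG

lemma eq_of_notMem {Q R : Finset V} {v z₁ z₂ : V} (hQ : G.IsNClique n Q)
    (hR : G.IsClique (R : Set V)) (hvQ : v ∈ Q) (hvR : v ∈ R) (h₁ : z₁ ∈ R) (h₂ : z₂ ∈ R)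
    (h₁' : z₁ ∉ Q) (h₂' : z₂ ∉ Q) : z₁ = z₂ := by
  by_contra hne
  rcases hG Q hQ.1 hQ.2 v hvQ z₁ z₂ (hR hvR h₁ (by rintro rfl; exact h₁' hvQ))
    (hR hvR h₂ (by rintro rfl; exact h₂' hvQ)) (hR h₁ h₂ hne) with h | h
  exacts [h₁' h, h₂' h]

lemma subset_of_isNClique_succ {P R : Finset V} {v : V} (hn : 1 ≤ n)
    (hP : G.IsNClique (n + 1) P) (hR : G.IsClique (R : Set V)) (hRc : 3 ≤ R.card) (hvP : v ∈ P)
    (hvR : v ∈ R) : R ⊆ P := by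
  classical
  intro z hz
  by_contra hzP
  obtain ⟨w, hw, hwz⟩ := Finset.exists_mem_ne
    (show 1 < (R.erase v).card by rw [Finset.card_erase_of_mem hvR]; omega) z
  obtain ⟨hwv, hwR⟩ := Finset.mem_erase.1 hw
  obtain ⟨u, hu, huv, hwu⟩ : ∃ u ∈ P, u ≠ v ∧ w ∉ P.erase u := by
    by_cases hwP : w ∈ P
    · exact ⟨w, hwP, hwv, Finset.notMem_erase w P⟩
    · obtain ⟨u, hu, huv⟩ := Finset.exists_mem_ne (show 1 < P.card by rw [hP.card_eq]; omega) v
      exact ⟨u, hu, huv, fun h => hwP (Finset.mem_of_mem_erase h)⟩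
  exact hwz (hG.eq_of_notMem (hP.erase_of_mem hu) hR (Finset.mem_erase.2 ⟨huv.symm, hvP⟩) hvR
    hwR hz hwu fun h => hzP (Finset.mem_of_mem_erase h))

lemma exists_mem_mem {Q R B : Finset V} {a : V} (hQ : G.IsNClique n Q) (hR : G.IsNClique n R)
    (haQ : a ∈ Q) (haR : a ∈ R) (hBQ : B ⊆ Q) (hB : 1 < B.card) : ∃ v ∈ B, v ∈ R := by
  by_contra! hcon
  obtain ⟨z₁, h₁, z₂, h₂, hne⟩ := Finset.one_lt_card.1 hB
  exact hne (hG.eq_of_notMem hR hQ.1 haR haQ (hBQ h₁) (hBQ h₂) (hcon _ h₁) (hcon _ h₂))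

lemma isKernel_subset {B R : Finset V} {v : V} (hB : IsKernel G n B)
    (hmax : ∀ P : Finset V, G.IsNClique (n + 1) P → ¬ B ⊆ P) (hR : G.IsNClique n R)
    (hvB : v ∈ B) (hvR : v ∈ R) : B ⊆ R := by
  classical
  intro u hu
  by_contra huR
  have hcard : 1 < (R \ B).card := by
    have hsub : R ∩ B ⊂ B := by
      refine Finset.ssubset_iff_subset_ne.2 ⟨Finset.inter_subset_right, fun h => huR ?_⟩
      rw [← h] at hu
      exact Finset.mem_of_mem_inter_left hu
    have := Finset.card_lt_card hsub
    have := Finset.card_sdiff_add_card_inter R B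
    have := hR.card_eq
    have := hB.2.1
    omega
  obtain ⟨z₁, h₁, z₂, h₂, hne⟩ := Finset.one_lt_card.1 hcard
  rw [Finset.mem_sdiff] at h₁ h₂
  have eq_or_eq : ∀ x, (∀ v ∈ B, G.Adj x v) → z₁ = x ∨ z₂ = x := by
    intro x hx
    by_contra! hcon
    exact hne (hG.eq_of_notMem (isNClique_insert_of_forall_adj hB.1 hB.2.1 hx) hR.1
      (Finset.mem_insert_of_mem hvB) hvR h₁.1 h₂.1 (by simp [hcon.1, h₁.2])
      (by simp [hcon.2, h₂.2]))
  obtain ⟨p, q, hpq, hp, hq⟩ := hB.2.2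
  have hadj : G.Adj p q := by
    have := hR.1 h₁.1 h₂.1 hne
    rcases eq_or_eq p hp with rfl | rfl <;> rcases eq_or_eq q hq with rfl | rfl
    exacts [absurd rfl hpq, this, this.symm, absurd rfl hpq]
  exact hmax _ (hB.isNClique_succ hp hq hadj)
    ((Finset.subset_insert _ _).trans (Finset.subset_insert _ _))

lemma isKernel_eq {B D : Finset V} {w : V} (hB : IsKernel G n B)
    (hmax : ∀ P : Finset V, G.IsNClique (n + 1) P → ¬ B ⊆ P) (hD : IsKernel G n D)
    (hwB : w ∈ B) (hwD : w ∈ D) : B = D := by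
  classical
  obtain ⟨hDcl, hDc, p, q, hpq, hp, hq⟩ := hD
  have hsub : ∀ z, (∀ v ∈ D, G.Adj z v) → B ⊆ insert z D := fun z hz =>
    hG.isKernel_subset hB hmax (isNClique_insert_of_forall_adj hDcl hDc hz) hwB
      (Finset.mem_insert_of_mem hwD)
  refine Finset.eq_of_subset_of_card_le (fun x hx => ?_) (by have := hB.2.1; omega)
  rcases Finset.mem_insert.1 (hsub p hp hx) with rfl | h
  · exact (Finset.mem_insert.1 (hsub q hq hx)).resolve_left hpq
  · exact h

lemma isKernel_inter [DecidableEq V] {Q R : Finset V} {v : V} (hQ : G.IsNClique n Q)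
    (hR : G.IsNClique n R) (hne : R ≠ Q) (hvQ : v ∈ Q) (hvR : v ∈ R) : IsKernel G n (Q ∩ R) := by
  have sdiff_nonempty : ∀ {S T : Finset V}, G.IsNClique n S → G.IsNClique n T → S ≠ T →
      (S \ T).Nonempty := fun hS hT hST => Finset.sdiff_nonempty.2 fun h =>
    hST (Finset.eq_of_subset_of_card_le h (by rw [hS.card_eq, hT.card_eq]))
  obtain ⟨x, hx⟩ := sdiff_nonempty hQ hR hne.symm
  obtain ⟨y, hy⟩ := sdiff_nonempty hR hQ hne
  have hcard : (Q \ R).card = 1 := by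
    refine le_antisymm (Finset.card_le_one.2 fun a ha b hb => ?_) (Finset.card_pos.2 ⟨x, hx⟩)
    rw [Finset.mem_sdiff] at ha hb
    exact hG.eq_of_notMem hR hQ.1 hvR hvQ ha.1 hb.1 ha.2 hb.2
  rw [Finset.mem_sdiff] at hx hy
  refine ⟨hQ.1.subset (by simp), ?_, x, y, fun h => hx.2 (h ▸ hy.1), fun b hb => ?_, fun b hb => ?_⟩
  · have := Finset.card_sdiff_add_card_inter Q R
    have := hQ.card_eq
    omega
  · exact hQ.1 hx.1 (Finset.mem_of_mem_inter_left hb)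
      fun h => hx.2 (h ▸ Finset.mem_of_mem_inter_right hb)
  · exact hR.1 hy.1 (Finset.mem_of_mem_inter_right hb)
      fun h => hy.2 (h ▸ Finset.mem_of_mem_inter_left hb)

lemma star_eq_of_isNClique_succ {P : Finset V} {a : V} (hn : 3 ≤ n)
    (hP : G.IsNClique (n + 1) P) (ha : a ∈ P) : star G n a = P := by
  ext b
  constructor
  · rintro ⟨B, hB, hclq, hb⟩
    rcases isSpecial_iff.1 hB with hB | hB
    · exact hG.subset_of_isNClique_succ (by omega) hP hB.1.1 (by rw [hB.1.card_eq]; exact hn) ha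
        (hB.mem_of_isClique_insert (by omega) hclq) hb
    · obtain ⟨R, hR, haR, hBR⟩ := hB.exists_isNClique hclq
      exact hG.subset_of_isNClique_succ (by omega) hP hR.1 (by rw [hR.card_eq]; exact hn) ha haR
        (hBR hb)
  · intro hb
    obtain ⟨B, hBP, hbB, hB⟩ := exists_isKernel_of_mem (by omega) hP (Finset.mem_coe.1 hb)
    refine ⟨B, isSpecial_iff.2 (Or.inr hB), hP.1.subset ?_, hbB⟩
    exact Set.insert_subset ha (by exact_mod_cast hBP)

lemma star_eq_of_isKernel {B : Finset V} {a : V} (hn : 3 ≤ n) (hB : IsKernel G n B)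
    (ha : G.IsClique (insert a (B : Set V)))
    (hno : ∀ P : Finset V, G.IsNClique (n + 1) P → a ∉ P) : star G n a = B := by
  classical
  obtain ⟨Q, hQ, haQ, hBQ⟩ := hB.exists_isNClique ha
  have hBc := hB.2.1
  have hmax : ∀ P : Finset V, G.IsNClique (n + 1) P → ¬ B ⊆ P := by
    intro P hP hBP
    obtain ⟨b, hb⟩ : B.Nonempty := Finset.card_pos.1 (by omega)
    exact hno P hP (hG.subset_of_isNClique_succ (by omega) hP hQ.1 (by rw [hQ.card_eq]; exact hn)
      (hBP hb) (hBQ hb) haQ)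
  refine Set.Subset.antisymm ?_ fun b hb => ⟨B, isSpecial_iff.2 (Or.inr hB), ha, hb⟩
  rintro b ⟨D, hD, hclq, hb⟩
  rcases isSpecial_iff.1 hD with hD | hD
  · have h := hD.2 Q hQ a haQ (hD.mem_of_isClique_insert (by omega) hclq)
    exact absurd (h ▸ hBQ) (hD.not_isKernel_subset (by omega) hB)
  · obtain ⟨R, hR, haR, hDR⟩ := hD.exists_isNClique hclq
    obtain ⟨v, hvB, hvR⟩ := hG.exists_mem_mem hQ hR haQ haR hBQ (by omega)
    have hBR := hG.isKernel_subset hB hmax hR hvB hvR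
    obtain ⟨w, hw⟩ : (B ∩ D).Nonempty := by
      have := Finset.card_le_card (Finset.union_subset hBR hDR)
      have := Finset.card_union_add_card_inter B D
      have := hD.2.1
      have := hR.card_eq
      exact Finset.card_pos.1 (by omega)
    rw [Finset.mem_inter] at hw
    rw [hG.isKernel_eq hB hmax hD hw.1 hw.2]
    exact hb

lemma star_cases (hn : 3 ≤ n) (a : V) :
    (∃ P : Finset V, G.IsNClique (n + 1) P ∧ a ∈ P ∧ star G n a = P) ∨
    (∃ B : Finset V, IsKernel G n B ∧ G.IsClique (insert a (B : Set V)) ∧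
      (∀ P : Finset V, G.IsNClique (n + 1) P → a ∉ P) ∧ star G n a = B) ∨
    (∃ Q : Finset V, IsIsolatedClique G n Q ∧ a ∈ Q ∧ star G n a = Q) ∨ star G n a = ∅ := by
  by_cases h1 : ∃ P : Finset V, G.IsNClique (n + 1) P ∧ a ∈ P
  · obtain ⟨P, hP, ha⟩ := h1
    exact Or.inl ⟨P, hP, ha, hG.star_eq_of_isNClique_succ hn hP ha⟩
  push Not at h1
  by_cases h2 : ∃ B : Finset V, IsKernel G n B ∧ G.IsClique (insert a (B : Set V))
  · obtain ⟨B, hB, ha⟩ := h2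
    exact Or.inr (Or.inl ⟨B, hB, ha, h1, hG.star_eq_of_isKernel hn hB ha h1⟩)
  by_cases h3 : ∃ Q : Finset V, IsIsolatedClique G n Q ∧ a ∈ Q
  · obtain ⟨Q, hQ, ha⟩ := h3
    exact Or.inr (Or.inr (Or.inl ⟨Q, hQ, ha, hQ.star_eq (by omega) ha⟩))
  · refine Or.inr (Or.inr (Or.inr (Set.eq_empty_iff_forall_notMem.2 ?_)))
    rintro b ⟨B, hB, hclq, -⟩
    rcases isSpecial_iff.1 hB with hB | hB
    · exact h3 ⟨B, hB, hB.mem_of_isClique_insert (by omega) hclq⟩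
    · exact h2 ⟨B, hB, hclq⟩

lemma encard_insert_star_le (hn : 3 ≤ n) (a : V) :
    (insert a (star G n a)).encard ≤ (n : ℕ∞) + 1 := by
  rcases hG.star_cases hn a with ⟨P, hP, ha, h⟩ | ⟨B, hB, -, -, h⟩ | ⟨Q, hQ, ha, h⟩ | h
  · rw [h, Set.insert_eq_of_mem (by exact ha), Set.encard_coe_eq_coe_finsetCard, hP.card_eq]
    simp
  · rw [h]
    refine (Set.encard_insert_le _ _).trans ?_
    rw [Set.encard_coe_eq_coe_finsetCard, ← hB.2.1]
    gcongr
    simp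
  · rw [h, Set.insert_eq_of_mem (by exact ha), Set.encard_coe_eq_coe_finsetCard, hQ.1.card_eq]
    exact le_self_add
  · rw [h]
    simp

lemma finite_star (hn : 3 ≤ n) (a : V) : (star G n a).Finite :=
  ((Set.finite_of_encard_le_coe (hG.encard_insert_star_le hn a))).subset (Set.subset_insert _ _)

lemma star_subset_of_mem {a c : V} (hn : 3 ≤ n) (hc : c ∈ star G n a) :
    star G n c ⊆ star G n a := by
  rcases hG.star_cases hn a with ⟨P, hP, -, h⟩ | ⟨B, hB, hclq, hno, h⟩ | ⟨Q, hQ, -, h⟩ | h <;>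
    rw [h] at hc ⊢
  · rw [hG.star_eq_of_isNClique_succ hn hP hc]
  · obtain ⟨Q, hQ, haQ, hBQ⟩ := hB.exists_isNClique hclq
    rw [hG.star_eq_of_isKernel hn hB (by rw [Set.insert_eq_of_mem hc]; exact hB.1)]
    exact fun P hP hcP => hno P hP (hG.subset_of_isNClique_succ (by omega) hP hQ.1
      (by rw [hQ.card_eq]; exact hn) hcP (hBQ hc) haQ)
  · rw [hQ.star_eq (by omega) hc]
  · exact absurd hc (Set.notMem_empty c)

lemma exists_isKernel_of_not_subset_star {Q : Finset V} {v : V} (hn : 2 ≤ n)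
    (hQ : G.IsNClique n Q) (hv : v ∈ Q) (hsub : ¬ (Q : Set V) ⊆ star G n v) :
    ∃ B ⊆ Q, IsKernel G n B ∧ (B : Set V) ⊆ star G n v := by
  classical
  obtain ⟨R, hR, x, hxR, hxQ, hne⟩ : ∃ R : Finset V, G.IsNClique n R ∧ ∃ x ∈ R, x ∈ Q ∧ R ≠ Q := by
    by_contra! hcon
    exact hsub (IsIsolatedClique.star_eq hn ⟨hQ, hcon⟩ hv).ge
  have hker := hG.isKernel_inter hQ hR hne hxQ hxR
  exact ⟨Q ∩ R, Finset.inter_subset_left, hker, fun b hb => ⟨Q ∩ R, isSpecial_iff.2 (Or.inr hker),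
    hQ.1.subset (Set.insert_subset hv (by simp)), hb⟩⟩

lemma mem_star_of_triangle {B : Finset V} {v y z : V} (hn : 3 ≤ n) (hB : IsKernel G n B)
    (hv : v ∈ B) (hvy : G.Adj v y) (hvz : G.Adj v z) (hyz : G.Adj y z) (hy : y ∉ B) (hz : z ∉ B) :
    y ∈ star G n v ∧ z ∈ star G n v := by
  classical
  obtain ⟨p, q, hpq, hp, hq⟩ := hB.2.2
  have eq_or_eq : ∀ x, (∀ v ∈ B, G.Adj x v) → y = x ∨ z = x := by
    intro x hx
    have hQ := isNClique_insert_of_forall_adj hB.1 hB.2.1 hx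
    exact (hG _ hQ.1 hQ.2 v (Finset.mem_insert_of_mem hv) y z hvy hvz hyz).imp
      (fun h => (Finset.mem_insert.1 h).resolve_right hy)
      fun h => (Finset.mem_insert.1 h).resolve_right hz
  have hyzB : (∀ v ∈ B, G.Adj y v) ∧ (∀ v ∈ B, G.Adj z v) := by
    rcases eq_or_eq p hp with rfl | rfl <;> rcases eq_or_eq q hq with rfl | rfl
    exacts [absurd rfl hpq, ⟨hp, hq⟩, ⟨hq, hp⟩, absurd rfl hpq]
  rw [hG.star_eq_of_isNClique_succ hn (hB.isNClique_succ hyzB.1 hyzB.2 hyz) (by simp [hv])]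
  simp

end CliqueTriangleFree

end Clusters

/-! ### Free amalgamation -/

section FreeAmalgam

variable {V₁ V₂ W : Type*} {G₁ : SimpleGraph V₁} {G₂ : SimpleGraph V₂} {H : SimpleGraph W}
  {p : Set (V₁ × V₂)}

/-- A set of pairs that is an isomorphism between induced subgraphs of `G₁` and `G₂`. -/
structure IsPartialIso (G₁ : SimpleGraph V₁) (G₂ : SimpleGraph V₂) (p : Set (V₁ × V₂)) : Prop where
  eq_iff : ∀ x ∈ p, ∀ y ∈ p, (x.1 = y.1 ↔ x.2 = y.2)
  adj_iff : ∀ x ∈ p, ∀ y ∈ p, (G₁.Adj x.1 y.1 ↔ G₂.Adj x.2 y.2)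

/-- `H` is the union of copies of `G₁` and `G₂` identified along `p`, without further edges. -/
structure IsFreeAmalgam (e₁ : G₁ ↪g H) (e₂ : G₂ ↪g H) (p : Set (V₁ × V₂)) : Prop where
  eq_iff : ∀ x y, e₁ x = e₂ y ↔ (x, y) ∈ p
  adj : ∀ a b, H.Adj a b → (a ∈ Set.range e₁ ∧ b ∈ Set.range e₁) ∨
    (a ∈ Set.range e₂ ∧ b ∈ Set.range e₂)
  mem : ∀ a, a ∈ Set.range e₁ ∨ a ∈ Set.range e₂

lemma exists_embeddings_eq_iff {V₁ V₂ : Type u} {p : Set (V₁ × V₂)}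
    (hp : ∀ x ∈ p, ∀ y ∈ p, (x.1 = y.1 ↔ x.2 = y.2)) :
    ∃ (W : Type u) (f₁ : V₁ ↪ W) (f₂ : V₂ ↪ W), (∀ x y, f₁ x = f₂ y ↔ (x, y) ∈ p) ∧
      ∀ a, a ∈ Set.range f₁ ∨ a ∈ Set.range f₂ := by
  classical
  let f₂ : V₂ → V₁ ⊕ {y : V₂ // ∀ x, (x, y) ∉ p} := fun y =>
    if h : ∃ x, (x, y) ∈ p then Sum.inl h.choose else Sum.inr ⟨y, fun x hx => h ⟨x, hx⟩⟩
  have inl_eq_iff : ∀ x y, Sum.inl x = f₂ y ↔ (x, y) ∈ p := by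
    intro x y
    by_cases h : ∃ x, (x, y) ∈ p
    · simp only [f₂, dif_pos h, Sum.inl.injEq]
      refine ⟨fun hx => hx ▸ h.choose_spec, fun hx => (hp _ hx _ h.choose_spec).2 rfl⟩
    · simpa [f₂, dif_neg h] using fun hx => h ⟨x, hx⟩
  have eq_inr_iff : ∀ y z, f₂ y = Sum.inr z ↔ y = z := by
    rintro y ⟨z, hz⟩
    by_cases h : ∃ x, (x, y) ∈ p
    · simp only [f₂, dif_pos h, reduceCtorEq, false_iff]
      rintro rfl
      exact h.elim hz
    · simp [f₂, dif_neg h]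
  have injective : Function.Injective f₂ := by
    intro y y' hyy'
    rcases hy : f₂ y with x | z
    · exact (hp _ ((inl_eq_iff x y).1 hy.symm) _ ((inl_eq_iff x y').1 (hyy' ▸ hy).symm)).1 rfl
    · exact ((eq_inr_iff y z).1 hy).trans ((eq_inr_iff y' z).1 (hyy' ▸ hy)).symm
  refine ⟨_, ⟨Sum.inl, Sum.inl_injective⟩, ⟨f₂, injective⟩, inl_eq_iff, ?_⟩
  rintro (x | z)
  exacts [Or.inl ⟨x, rfl⟩, Or.inr ⟨z, (eq_inr_iff _ _).2 rfl⟩]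

lemma IsPartialIso.symm (hp : IsPartialIso G₁ G₂ p) : IsPartialIso G₂ G₁ (Prod.swap ⁻¹' p) :=
  ⟨fun _ hx _ hy => (hp.eq_iff _ hx _ hy).symm, fun _ hx _ hy => (hp.adj_iff _ hx _ hy).symm⟩

lemma IsPartialIso.adj_of_map_adj {f₁ : V₁ ↪ W} {f₂ : V₂ ↪ W} (hp : IsPartialIso G₁ G₂ p)
    (hf : ∀ x y, f₁ x = f₂ y ↔ (x, y) ∈ p) {a b : V₁} (h : (G₂.map f₂).Adj (f₁ a) (f₁ b)) :
    G₁.Adj a b := by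
  obtain ⟨c, d, hcd, hc, hd⟩ := (SimpleGraph.map_adj _ _ _ _).1 h
  exact (hp.adj_iff _ ((hf a c).1 hc.symm) _ ((hf b d).1 hd.symm)).2 hcd

theorem IsPartialIso.exists_isFreeAmalgam {V₁ V₂ : Type u} {G₁ : SimpleGraph V₁}
    {G₂ : SimpleGraph V₂} {p : Set (V₁ × V₂)} (hp : IsPartialIso G₁ G₂ p) :
    ∃ (W : Type u) (H : SimpleGraph W) (e₁ : G₁ ↪g H) (e₂ : G₂ ↪g H), IsFreeAmalgam e₁ e₂ p := by
  obtain ⟨W, f₁, f₂, hf, hrange⟩ := exists_embeddings_eq_iff hp.eq_iff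
  have hf' : ∀ y x, f₂ y = f₁ x ↔ (y, x) ∈ Prod.swap ⁻¹' p := fun y x => eq_comm.trans (hf x y)
  refine ⟨W, G₁.map f₁ ⊔ G₂.map f₂, ⟨f₁, fun {a b} => ?_⟩, ⟨f₂, fun {a b} => ?_⟩, hf,
    fun a b hab => ?_, hrange⟩
  · rw [SimpleGraph.sup_adj, SimpleGraph.map_adj_apply]
    exact ⟨fun h => h.elim id (hp.adj_of_map_adj hf), Or.inl⟩
  · rw [SimpleGraph.sup_adj, SimpleGraph.map_adj_apply]
    exact ⟨fun h => h.elim (hp.symm.adj_of_map_adj hf') id, Or.inr⟩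
  · rw [SimpleGraph.sup_adj, SimpleGraph.map_adj, SimpleGraph.map_adj] at hab
    rcases hab with ⟨c, d, -, rfl, rfl⟩ | ⟨c, d, -, rfl, rfl⟩
    exacts [Or.inl ⟨⟨c, rfl⟩, ⟨d, rfl⟩⟩, Or.inr ⟨⟨c, rfl⟩, ⟨d, rfl⟩⟩]

namespace IsFreeAmalgam

variable {e₁ : G₁ ↪g H} {e₂ : G₂ ↪g H} (h : IsFreeAmalgam e₁ e₂ p)
include h

lemma countable [Countable V₁] [Countable V₂] : Countable W :=
  Set.countable_univ_iff.1 <|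
    ((Set.countable_range e₁).union (Set.countable_range e₂)).mono fun a _ => h.mem a

lemma symm : IsFreeAmalgam e₂ e₁ (Prod.swap ⁻¹' p) :=
  ⟨fun x y => eq_comm.trans (h.eq_iff y x), fun a b hab => (h.adj a b hab).symm,
    fun a => (h.mem a).symm⟩

lemma clique_subset_range {S : Set W} (hS : H.IsClique S) :
    S ⊆ Set.range e₁ ∨ S ⊆ Set.range e₂ := by
  by_contra! hcon
  obtain ⟨a, haS, ha⟩ := Set.not_subset.1 hcon.1
  obtain ⟨b, hbS, hb⟩ := Set.not_subset.1 hcon.2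
  have hab : a ≠ b := by
    rintro rfl
    exact (h.mem a).elim ha hb
  rcases h.adj a b (hS haS hbS hab) with h' | h'
  exacts [ha h'.1, hb h'.2]

end IsFreeAmalgam

end FreeAmalgam

section FreeAmalgamation

variable {n : ℕ} {V₁ V₂ W : Type*} {G₁ : SimpleGraph V₁} {G₂ : SimpleGraph V₂} {H : SimpleGraph W}
  {p : Set (V₁ × V₂)}

/-- A partial isomorphism between star-closed sets that preserves kernels in both directions. -/
structure IsClosedPartialIso (n : ℕ) (G₁ : SimpleGraph V₁) (G₂ : SimpleGraph V₂)
    (p : Set (V₁ × V₂)) : Prop extends IsPartialIso G₁ G₂ p where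
  left : ∀ x ∈ p, ∀ a ∈ star G₁ n x.1, ∃ b, (a, b) ∈ p
  right : ∀ x ∈ p, ∀ b ∈ star G₂ n x.2, ∃ a, (a, b) ∈ p
  isKernel_iff : ∀ (B : Finset V₁) (D : Finset V₂), (∀ b ∈ B, ∃ d ∈ D, (b, d) ∈ p) →
    (∀ d ∈ D, ∃ b ∈ B, (b, d) ∈ p) → (IsKernel G₁ n B ↔ IsKernel G₂ n D)

lemma IsClosedPartialIso.symm (hp : IsClosedPartialIso n G₁ G₂ p) :
    IsClosedPartialIso n G₂ G₁ (Prod.swap ⁻¹' p) where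
  toIsPartialIso := hp.toIsPartialIso.symm
  left _ hx := hp.right _ hx
  right _ hx := hp.left _ hx
  isKernel_iff B D hB hD := (hp.isKernel_iff D B hD hB).symm

lemma isNClique_preimage (e : G₁ ↪g H) {Q : Finset W} (hQ : H.IsNClique n Q)
    (hr : (Q : Set W) ⊆ Set.range e) : G₁.IsNClique n (Q.preimage e e.injective.injOn) := by
  classical
  refine ⟨fun a ha b hb hab => ?_, ?_⟩
  · rw [Finset.coe_preimage] at ha hb
    exact e.map_adj_iff.1 (hQ.1 ha hb (e.injective.ne hab))
  · rw [← Finset.card_image_of_injective _ e.injective, Finset.image_preimage,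
      Finset.filter_true_of_mem hr, hQ.card_eq]

lemma CliqueTriangleFree.mem_or_mem_of_subset_range (hG : CliqueTriangleFree n G₁) (e : G₁ ↪g H)
    {Q : Finset W} (hQ : H.IsNClique n Q) (hr : (Q : Set W) ⊆ Set.range e) {v x y : V₁}
    (hv : e v ∈ Q) (hvx : G₁.Adj v x) (hvy : G₁.Adj v y) (hxy : G₁.Adj x y) :
    e x ∈ Q ∨ e y ∈ Q := by
  have hQ' := isNClique_preimage e hQ hr
  simpa only [Finset.mem_preimage] using
    hG _ hQ'.1 hQ'.2 v (Finset.mem_preimage.2 hv) x y hvx hvy hxy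

lemma IsFreeAmalgam.exists_isKernel {e₁ : G₁ ↪g H} {e₂ : G₂ ↪g H} (hn : 2 ≤ n)
    (h : IsFreeAmalgam e₁ e₂ p) (h₁ : CliqueTriangleFree n G₁) (hp : IsClosedPartialIso n G₁ G₂ p)
    {Q : Finset W} (hQ : H.IsNClique n Q) (hr₁ : (Q : Set W) ⊆ Set.range e₁)
    (hr₂ : ¬ (Q : Set W) ⊆ Set.range e₂) {v : V₂} (hv : e₂ v ∈ Q) :
    ∃ D : Finset V₂, IsKernel G₂ n D ∧ v ∈ D ∧ ∀ d ∈ D, e₂ d ∈ Q := by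
  classical
  obtain ⟨w, hwQ, hw⟩ := Set.not_subset.1 hr₂
  obtain ⟨w, rfl⟩ := hr₁ hwQ
  obtain ⟨v₁, hv₁⟩ := hr₁ hv
  have hvp : (v₁, v) ∈ p := (h.eq_iff _ _).1 hv₁
  have mem_range : ∀ a ∈ star G₁ n v₁, e₁ a ∈ Set.range e₂ := fun a ha =>
    (hp.left _ hvp a ha).imp fun b hb => ((h.eq_iff a b).2 hb).symm
  have hQ₁ := isNClique_preimage e₁ hQ hr₁
  have hwQ₁ := Finset.mem_preimage (hf := e₁.injective.injOn).2 hwQ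
  have hvQ₁ := Finset.mem_preimage (hf := e₁.injective.injOn).2 (hv₁ ▸ hv)
  obtain ⟨B, hBQ, hB, hBs⟩ := h₁.exists_isKernel_of_not_subset_star hn hQ₁ hvQ₁
    fun hs => hw (mem_range w (hs hwQ₁))
  have hwB : w ∉ B := fun hwB => hw (mem_range w (hBs hwB))
  have hvB : v₁ ∈ B := by
    have hQB : insert w B = Q.preimage e₁ e₁.injective.injOn :=
      Finset.eq_of_subset_of_card_le (Finset.insert_subset hwQ₁ hBQ)
        (by rw [Finset.card_insert_of_notMem hwB, hB.2.1, hQ₁.card_eq])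
    rw [← hQB] at hvQ₁
    refine (Finset.mem_insert.1 hvQ₁).resolve_left ?_
    rintro rfl
    exact hw ⟨v, hv₁.symm⟩
  let D := (B.image e₁).preimage e₂ e₂.injective.injOn
  have mem_D_iff : ∀ d, d ∈ D ↔ ∃ b ∈ B, (b, d) ∈ p := fun d => by
    simp only [D, Finset.mem_preimage, Finset.mem_image, h.eq_iff]
  refine ⟨D, (hp.isKernel_iff B D (fun b hb => ?_) fun d => (mem_D_iff d).1).1 hB,
    (mem_D_iff v).2 ⟨v₁, hvB, hvp⟩, fun d hd => ?_⟩
  · obtain ⟨d, hd⟩ := hp.left _ hvp b (hBs hb)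
    exact ⟨d, (mem_D_iff d).2 ⟨b, hb, hd⟩, hd⟩
  · obtain ⟨b, hb, hbd⟩ := (mem_D_iff d).1 hd
    exact (h.eq_iff _ _).2 hbd ▸ Finset.mem_preimage.1 (hBQ hb)

lemma IsFreeAmalgam.mem_or_mem {e₁ : G₁ ↪g H} {e₂ : G₂ ↪g H} (hn : 3 ≤ n)
    (h : IsFreeAmalgam e₁ e₂ p) (h₁ : CliqueTriangleFree n G₁) (h₂ : CliqueTriangleFree n G₂)
    (hp : IsClosedPartialIso n G₁ G₂ p) {Q : Finset W} (hQ : H.IsNClique n Q)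
    (hr : (Q : Set W) ⊆ Set.range e₁) {v x y : V₂} (hv : e₂ v ∈ Q) (hvx : G₂.Adj v x)
    (hvy : G₂.Adj v y) (hxy : G₂.Adj x y) : e₂ x ∈ Q ∨ e₂ y ∈ Q := by
  by_cases hr₂ : (Q : Set W) ⊆ Set.range e₂
  · exact h₂.mem_or_mem_of_subset_range e₂ hQ hr₂ hv hvx hvy hxy
  obtain ⟨D, hD, hvD, hDQ⟩ := h.exists_isKernel (by omega) h₁ hp hQ hr hr₂ hv
  by_contra! hcon
  obtain ⟨hx, hy⟩ := h₂.mem_star_of_triangle hn hD hvD hvx hvy hxy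
    (fun hd => hcon.1 (hDQ _ hd)) (fun hd => hcon.2 (hDQ _ hd))
  obtain ⟨v₁, hv₁⟩ := hr hv
  have hvp := (h.eq_iff _ _).1 hv₁
  obtain ⟨x₁, hx₁⟩ := hp.right _ hvp _ hx
  obtain ⟨y₁, hy₁⟩ := hp.right _ hvp _ hy
  rw [← (h.eq_iff _ _).2 hx₁, ← (h.eq_iff _ _).2 hy₁] at hcon
  exact (h₁.mem_or_mem_of_subset_range e₁ hQ hr (hv₁ ▸ hv) ((hp.adj_iff _ hvp _ hx₁).2 hvx)
    ((hp.adj_iff _ hvp _ hy₁).2 hvy) ((hp.adj_iff _ hx₁ _ hy₁).2 hxy)).elim hcon.1 hcon.2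

theorem IsFreeAmalgam.cliqueTriangleFree {e₁ : G₁ ↪g H} {e₂ : G₂ ↪g H} (hn : 3 ≤ n)
    (h : IsFreeAmalgam e₁ e₂ p) (h₁ : CliqueTriangleFree n G₁) (h₂ : CliqueTriangleFree n G₂)
    (hp : IsClosedPartialIso n G₁ G₂ p) : CliqueTriangleFree n H := by
  intro Q hQ hc v hv x y hvx hvy hxy
  have htriangle : H.IsClique ({v, x, y} : Set W) := by
    simp [SimpleGraph.isClique_insert, hvx, hvy, hxy]
  rcases h.clique_subset_range htriangle with hT | hT <;>
    obtain ⟨⟨v, rfl⟩, ⟨x, rfl⟩, ⟨y, rfl⟩⟩ :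
      v ∈ Set.range _ ∧ x ∈ Set.range _ ∧ y ∈ Set.range _ :=
      ⟨hT (by simp), hT (by simp), hT (by simp)⟩ <;>
    rw [SimpleGraph.Embedding.map_adj_iff] at hvx hvy hxy <;>
    rcases h.clique_subset_range hQ with hr | hr
  · exact h₁.mem_or_mem_of_subset_range e₁ ⟨hQ, hc⟩ hr hv hvx hvy hxy
  · exact h.symm.mem_or_mem hn h₂ h₁ hp.symm ⟨hQ, hc⟩ hr hv hvx hvy hxy
  · exact h.mem_or_mem hn h₁ h₂ hp ⟨hQ, hc⟩ hr hv hvx hvy hxy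
  · exact h₂.mem_or_mem_of_subset_range e₂ ⟨hQ, hc⟩ hr hv hvx hvy hxy

end FreeAmalgamation

/-! ### Algebraic closure -/

section StarClosure

lemma encard_biUnion_le_mul {ι α : Type*} (A : Set ι) {f : ι → Set α} {k : ℕ∞}
    (hf : ∀ i ∈ A, (f i).encard ≤ k) : (⋃ i ∈ A, f i).encard ≤ k * A.encard := by
  rcases eq_or_ne k 0 with rfl | hk
  · simp_all
  rcases A.finite_or_infinite with hA | hA
  · induction A, hA using Set.Finite.induction_on with
    | empty => simp
    | @insert a s has _ ih =>
      rw [Set.biUnion_insert, Set.encard_insert_of_notMem has, mul_add, mul_one, add_comm]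
      exact (Set.encard_union_le _ _).trans (add_le_add (hf a (Set.mem_insert a s))
        (ih fun i hi => hf i (Set.mem_insert_of_mem a hi)))
  · rw [hA.encard_eq, ENat.mul_top hk]
    exact le_top

namespace IsEmbeddingOn

variable {V V' : Type*} {H : SimpleGraph V'} {G : SimpleGraph V} {n : ℕ} {S : Set V'} {h : V' → V}
  (hh : IsEmbeddingOn H G S h)
include hh

lemma isClique_image {T : Set V'} (hT : H.IsClique T) (hTS : T ⊆ S) : G.IsClique (h '' T) := by
  rintro _ ⟨x, hx, rfl⟩ _ ⟨y, hy, rfl⟩ hne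
  exact (hh.2 x (hTS hx) y (hTS hy)).2 (hT hx hy (by rintro rfl; exact hne rfl))

lemma isNClique_image [DecidableEq V] {Q : Finset V'} (hQ : H.IsNClique n Q) (hQS : ↑Q ⊆ S) :
    G.IsNClique n (Q.image h) := by
  refine ⟨?_, by rw [Finset.card_image_of_injOn (hh.1.mono hQS), hQ.card_eq]⟩
  rw [Finset.coe_image]
  exact hh.isClique_image hQ.1 hQS

lemma isKernel_image [DecidableEq V] {B : Finset V'} (hB : H.IsClique (B : Set V'))
    (hc : B.card + 1 = n) (hBS : ↑B ⊆ S) {x y : V'} (hxy : x ≠ y) (hxS : x ∈ S) (hyS : y ∈ S)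
    (hx : ∀ v ∈ B, H.Adj x v) (hy : ∀ v ∈ B, H.Adj y v) : IsKernel G n (B.image h) := by
  have hcl := hh.isNClique_image ⟨hB, rfl⟩ hBS
  refine ⟨hcl.1, by rw [hcl.card_eq, hc], h x, h y, hh.1.ne hxS hyS hxy, ?_, ?_⟩ <;>
    rintro _ hv <;> obtain ⟨b, hb, rfl⟩ := Finset.mem_image.1 hv
  exacts [(hh.2 _ hxS _ (hBS hb)).2 (hx b hb), (hh.2 _ hyS _ (hBS hb)).2 (hy b hb)]

end IsEmbeddingOn

variable {V : Type u} {G : SimpleGraph V} {n : ℕ} {A : Set V}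

namespace CliqueTriangleFree

lemma star_subset_acl (hG : CliqueTriangleFree n G) (hn : 3 ≤ n) {a : V} (ha : a ∈ A) :
    star G n a ⊆ acl G A := by
  classical
  rintro b ⟨B, hB, hclq, hb⟩
  rcases isSpecial_iff.1 hB with hB | ⟨hcl, hc, x, y, hxy, hx, hy⟩
  · have haB := hB.mem_of_isClique_insert (by omega) hclq
    refine mem_acl_of_finite B.finite_toSet (B.finite_toSet.subset ?_)
    rintro _ ⟨h, hh, hfix, rfl⟩
    have himage := hB.2 _ (hh.isNClique_image hB.1 subset_rfl) a
      (Finset.mem_image.2 ⟨a, haB, hfix a haB ha⟩) haB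
    exact himage ▸ Finset.mem_coe.2 (Finset.mem_image_of_mem h hb)
  · refine mem_acl_of_finite (S := insert a (insert x (insert y (B : Set V))))
      (((B.finite_toSet.insert y).insert x).insert a) ((hG.finite_star hn a).subset ?_)
    rintro _ ⟨h, hh, hfix, rfl⟩
    have hsub : (B : Set V) ⊆ insert a (insert x (insert y (B : Set V))) := by
      intro z hz
      simp [Finset.mem_coe.1 hz]
    have hcl_image := hh.isClique_image hclq (Set.insert_subset (by simp) hsub)
    rw [Set.image_insert_eq, hfix a (by simp) ha, ← Finset.coe_image] at hcl_image
    exact ⟨B.image h, isSpecial_iff.2 (Or.inr (hh.isKernel_image hcl hc hsub hxy (by simp)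
      (by simp) hx hy)), hcl_image, Finset.mem_image_of_mem h hb⟩

lemma star_subset_biUnion (hG : CliqueTriangleFree n G) (hn : 3 ≤ n) :
    ∀ c ∈ ⋃ a ∈ A, insert a (star G n a), star G n c ⊆ ⋃ a ∈ A, insert a (star G n a) := by
  intro c hc
  obtain ⟨a, ha, hca⟩ := Set.mem_iUnion₂.1 hc
  refine subset_trans ?_ (Set.subset_biUnion_of_mem (u := fun a => insert a (star G n a)) ha)
  rcases hca with rfl | hca
  exacts [Set.subset_insert _ _, (hG.star_subset_of_mem hn hca).trans (Set.subset_insert _ _)]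

end CliqueTriangleFree

lemma isClosedPartialIso_diagonal (hA : ∀ a ∈ A, star G n a ⊆ A) :
    IsClosedPartialIso n G G ((fun a => (a, a)) '' A) where
  eq_iff := by
    rintro _ ⟨x, -, rfl⟩ _ ⟨y, -, rfl⟩
    rfl
  adj_iff := by
    rintro _ ⟨x, -, rfl⟩ _ ⟨y, -, rfl⟩
    rfl
  left := by
    rintro _ ⟨x, hx, rfl⟩ a ha
    exact ⟨a, a, hA x hx ha, rfl⟩
  right := by
    rintro _ ⟨x, hx, rfl⟩ a ha
    exact ⟨a, a, hA x hx ha, rfl⟩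
  isKernel_iff B D hB hD := by
    have : B = D := by
      ext b
      constructor
      · intro hb
        obtain ⟨d, hd, c, -, ⟨⟩⟩ := hB b hb
        exact hd
      · intro hd
        obtain ⟨d, hd, c, -, ⟨⟩⟩ := hD b hd
        exact hd
    rw [this]

namespace IsExistentiallyComplete

lemma cliqueTriangleFree (hn : 1 ≤ n) (hG : IsExistentiallyComplete (cliqueWithTriangle n) G) :
    CliqueTriangleFree n G :=
  cliqueTriangleFree_of_free hn hG.free

/-- Amalgamate two copies of `G` over `A`. A solution `b` outside `A` would, after retraction to
the first copy, yield a solution distinct from all those of `G`. -/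
lemma acl_subset (hn : 3 ≤ n) (hG : IsExistentiallyComplete (cliqueWithTriangle n) G)
    (hA : ∀ a ∈ A, star G n a ⊆ A) : acl G A ⊆ A := by
  intro b hb
  have : Nonempty V := ⟨b⟩
  obtain ⟨S, hS, hbS, hfin⟩ := exists_finite_of_mem_acl hb
  set X := {x | ∃ h : V → V, IsEmbeddingOn G G S h ∧ (∀ a ∈ S, a ∈ A → h a = a) ∧ h b = x}
  have hfree := hG.cliqueTriangleFree (by omega)
  have hp := isClosedPartialIso_diagonal hA
  obtain ⟨W, H, e₁, e₂, hH⟩ := hp.exists_isFreeAmalgam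
  obtain ⟨h, hh, hfix⟩ := hG.exists_retraction e₁ (S := e₂ '' S ∪ e₁ '' (X ∪ S ∩ A))
    (free_of_cliqueTriangleFree (by omega) (hH.cliqueTriangleFree hn hfree hfree hp))
    ((hS.image _).union ((hfin.union (hS.inter_of_left A)).image _))
  have hx : h (e₂ b) ∈ X := by
    refine ⟨h ∘ e₂, ⟨fun x hx y hy e => ?_, fun x hx y hy => ?_⟩, fun a haS haA => ?_, rfl⟩
    · exact e₂.injective (hh.1 (Or.inl ⟨x, hx, rfl⟩) (Or.inl ⟨y, hy, rfl⟩) e)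
    · rw [← e₂.map_adj_iff (v := x)]
      exact hh.2 _ (Or.inl ⟨x, hx, rfl⟩) _ (Or.inl ⟨y, hy, rfl⟩)
    · rw [Function.comp_apply, ← (hH.eq_iff a a).2 ⟨a, haA, rfl⟩]
      exact hfix a (Or.inr ⟨a, Or.inr ⟨haS, haA⟩, rfl⟩)
  have hmem : e₁ (h (e₂ b)) ∈ e₂ '' S ∪ e₁ '' (X ∪ S ∩ A) := Or.inr ⟨_, Or.inl hx, rfl⟩
  obtain ⟨c, hc, e⟩ := (hH.eq_iff _ _).1 (hh.1 hmem (Or.inl ⟨b, hbS, rfl⟩) (hfix _ hmem))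
  rwa [show c = b from (Prod.ext_iff.1 e).2] at hc

theorem eq_acl_iff (hn : 3 ≤ n) (hG : IsExistentiallyComplete (cliqueWithTriangle n) G) :
    A = acl G A ↔ ∀ a ∈ A, star G n a ⊆ A := by
  refine ⟨fun h a ha => ?_, fun h => subset_acl.antisymm (hG.acl_subset hn h)⟩
  rw [h]
  exact (hG.cliqueTriangleFree (by omega)).star_subset_acl hn ha

theorem encard_acl_le (hn : 3 ≤ n) (hG : IsExistentiallyComplete (cliqueWithTriangle n) G) :
    (acl G A).encard ≤ ((n : ℕ∞) + 1) * A.encard := by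
  have hfree := hG.cliqueTriangleFree (by omega)
  have hsub : A ⊆ ⋃ a ∈ A, insert a (star G n a) :=
    fun a ha => Set.mem_biUnion ha (Set.mem_insert _ _)
  calc (acl G A).encard ≤ (⋃ a ∈ A, insert a (star G n a)).encard :=
        Set.encard_le_encard ((acl_mono hsub).trans
          (hG.acl_subset hn (hfree.star_subset_biUnion hn)))
    _ ≤ ((n : ℕ∞) + 1) * A.encard :=
        encard_biUnion_le_mul A fun a _ => hfree.encard_insert_star_le hn a

end IsExistentiallyComplete

end StarClosure

/-! ### Existence of existentially complete extensions -/

section Generic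

variable {P : Type*} [Preorder P]

/-- The Rasiowa–Sikorski lemma, phrased for increasing sequences. -/
lemma exists_monotone_forall_mem {ι : Type*} [Countable ι] (p : P) (D : ι → Order.Cofinal P) :
    ∃ f : ℕ → P, f 0 = p ∧ Monotone f ∧ ∀ i, ∃ s, f s ∈ D i := by
  have := Encodable.ofCountable ι
  exact ⟨Order.sequenceOfCofinals p D, rfl, Order.sequenceOfCofinals.monotone p D,
    fun i => ⟨_, Order.sequenceOfCofinals.encode_mem p D i⟩⟩

lemma isCofinal_mem_or_forall_notMem (A : Set P) :
    IsCofinal {q | q ∈ A ∨ ∀ r, q ≤ r → r ∉ A} := by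
  intro p
  by_cases h : ∃ q ∈ A, p ≤ q
  · obtain ⟨q, hq, hpq⟩ := h
    exact ⟨q, Or.inl hq, hpq⟩
  · exact ⟨p, Or.inr fun r hr hrA => h ⟨r, hrA, hr⟩, le_rfl⟩

end Generic

lemma exists_injOn_infinite_compl {X Y : Type*} {A : Set X} (hA : Aᶜ.Infinite) (e : A ↪ Y)
    {S : Set Y} (hS : S.Finite) : ∃ g : Y → X, Set.InjOn g (Set.range e ∪ S) ∧
      (∀ x, g (e x) = x) ∧ (g '' (Set.range e ∪ S))ᶜ.Infinite := by
  have : Nonempty X := hA.nonempty.to_type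
  obtain ⟨g₀, hg₀, hinj⟩ := hS.exists_injOn_of_encard_le (t := Aᶜ) (by simp [hA.encard_eq])
  let g := Function.extend e Subtype.val g₀
  have g_old : ∀ x, g (e x) = x := fun x => e.injective.extend_apply _ _ x
  have g_new : ∀ z ∈ S \ Set.range e, g z = g₀ z := fun z hz => Function.extend_apply' _ _ _ hz.2
  refine ⟨g, ?_, g_old, (hA.sdiff (hS.image g)).mono ?_⟩
  · rw [← Set.union_sdiff_self, Set.injOn_union Set.disjoint_sdiff_right]
    refine ⟨?_, fun z hz w hw hzw => hinj hz.1 hw.1 ?_, ?_⟩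
    · rintro _ ⟨x, rfl⟩ _ ⟨y, rfl⟩ hxy
      rw [g_old, g_old] at hxy
      rw [Subtype.ext hxy]
    · rwa [g_new z hz, g_new w hw] at hzw
    · rintro _ ⟨x, rfl⟩ w hw hxw
      rw [g_old, g_new w hw] at hxw
      exact hg₀ hw.1 (hxw ▸ x.2)
  · rintro x ⟨hx, hxS⟩ ⟨_, ⟨a, rfl⟩ | hz, rfl⟩
    · exact hx (by rw [g_old]; exact a.2)
    · exact hxS ⟨_, hz, rfl⟩

/-- The conditions of the forcing that constructs existentially complete graphs: `C`-free graphs on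
co-infinite subsets of `X`, of which only the restriction of `graph` to `verts` matters. -/
structure PartialGraph {W : Type v} (C : SimpleGraph W) (X : Type u) where
  verts : Set X
  graph : SimpleGraph X
  infinite_compl : vertsᶜ.Infinite
  free : C.Free (graph.induce verts)

namespace PartialGraph

variable {W : Type v} {C : SimpleGraph W} {X : Type u}

/-- `p ≤ q` if `p` is an induced subgraph of `q`. -/
instance : Preorder (PartialGraph C X) where
  le p q := p.verts ⊆ q.verts ∧ ∀ x ∈ p.verts, ∀ y ∈ p.verts, (p.graph.Adj x y ↔ q.graph.Adj x y)
  le_refl p := ⟨subset_rfl, fun _ _ _ _ => Iff.rfl⟩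
  le_trans p q r hpq hqr := ⟨hpq.1.trans hqr.1, fun x hx y hy =>
    (hpq.2 x hx y hy).trans (hqr.2 x (hpq.1 hx) y (hpq.1 hy))⟩

/-- The copy of a `C`-free graph under an embedding of its vertices in `X`. -/
def ofEmbedding {V : Type*} {G : SimpleGraph V} (hG : C.Free G) (φ : V ↪ X)
    (hφ : (Set.range φ)ᶜ.Infinite) : PartialGraph C X where
  verts := Set.range φ
  graph := G.map φ
  infinite_compl := hφ
  free := by
    let i : (G.map φ).induce (Set.range φ) ≃g G :=
      ⟨(Equiv.ofInjective φ φ.injective).symm, by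
        rintro ⟨_, x, rfl⟩ ⟨_, y, rfl⟩
        simp⟩
    exact free_of_embedding i.toEmbedding hG

lemma exists_extension (p : PartialGraph C X) {V : Type*} {H : SimpleGraph V}
    (e : p.graph.induce p.verts ↪g H) (hH : C.Free H) {S : Set V} (hS : S.Finite) :
    ∃ (q : PartialGraph C X) (g : V → X), p ≤ q ∧
      IsEmbeddingOn H q.graph (Set.range e ∪ S) g ∧ (∀ x, g (e x) = x) ∧
      ∀ z ∈ Set.range e ∪ S, g z ∈ q.verts := by
  obtain ⟨g, hinj, g_old, hinf⟩ := exists_injOn_infinite_compl p.infinite_compl e.toEmbedding hS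
  change ∀ x, g (e x) = x at g_old
  let φ : ↥(Set.range e ∪ S) ↪ X := ⟨fun z => g z, hinj.injective⟩
  have hrange : Set.range φ = g '' (Set.range e ∪ S) := Set.image_eq_range g _ |>.symm
  let q : PartialGraph C X := ofEmbedding
    (free_of_embedding (SimpleGraph.Embedding.induce (G := H) (Set.range e ∪ S)) hH) φ
    (by rw [hrange]; exact hinf)
  have mem_verts : ∀ z ∈ Set.range e ∪ S, g z ∈ q.verts := fun z hz => ⟨⟨z, hz⟩, rfl⟩
  have hemb : IsEmbeddingOn H q.graph (Set.range e ∪ S) g :=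
    ⟨hinj, fun z hz w hw => SimpleGraph.map_adj_apply (G := H.induce _) (f := φ) (a := ⟨z, hz⟩)
      (b := ⟨w, hw⟩)⟩
  refine ⟨q, g, ⟨fun x hx => ?_, fun x hx y hy => ?_⟩, hemb, g_old, mem_verts⟩
  · have := mem_verts (e ⟨x, hx⟩) (Or.inl ⟨_, rfl⟩)
    rwa [g_old] at this
  · have := hemb.2 (e ⟨x, hx⟩) (Or.inl ⟨_, rfl⟩) (e ⟨y, hy⟩) (Or.inl ⟨_, rfl⟩)
    rw [e.map_adj_iff, g_old, g_old] at this
    exact this.symm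

/-- The conditions in which some tuple has the given pattern over the parameters `a`. -/
def realizing (C : SimpleGraph W) {m k : ℕ} (a : Fin m → X) (P : Pattern (Fin m ⊕ Fin k)) :
    Set (PartialGraph C X) :=
  {p | (∀ i, a i ∈ p.verts) ∧
    ∃ y : Fin k → X, (∀ j, y j ∈ p.verts) ∧ pattern p.graph (Sum.elim a y) = P}

lemma exists_generic [Countable X] (p : PartialGraph C X) : ∃ f : ℕ → PartialGraph C X,
    f 0 = p ∧ Monotone f ∧ ∀ (m k : ℕ) (a : Fin m → X) (P : Pattern (Fin m ⊕ Fin k)),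
      ∃ s, f s ∈ realizing C a P ∨ ∀ q, f s ≤ q → q ∉ realizing C a P := by
  obtain ⟨f, hf0, hf, hgen⟩ := exists_monotone_forall_mem p
    fun t : Σ mk : ℕ × ℕ, (Fin mk.1 → X) × Pattern (Fin mk.1 ⊕ Fin mk.2) =>
      ⟨_, isCofinal_mem_or_forall_notMem (realizing C t.2.1 t.2.2)⟩
  exact ⟨f, hf0, hf, fun m k a P => hgen ⟨(m, k), a, P⟩⟩

/-- The union of an increasing sequence of conditions. -/
def limit (f : ℕ → PartialGraph C X) : SimpleGraph (⋃ s, (f s).verts) where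
  Adj x y := ∃ s, x.1 ∈ (f s).verts ∧ y.1 ∈ (f s).verts ∧ (f s).graph.Adj x y
  symm := ⟨fun _ _ ⟨s, hx, hy, hxy⟩ => ⟨s, hy, hx, hxy.symm⟩⟩
  loopless := ⟨fun _ ⟨_, _, _, hxx⟩ => hxx.ne rfl⟩

section Limit

variable {f : ℕ → PartialGraph C X} (hf : Monotone f)
include hf

lemma limit_adj_iff {x y : ⋃ s, (f s).verts} {s : ℕ} (hx : x.1 ∈ (f s).verts)
    (hy : y.1 ∈ (f s).verts) : (limit f).Adj x y ↔ (f s).graph.Adj x y := by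
  refine ⟨?_, fun h => ⟨s, hx, hy, h⟩⟩
  rintro ⟨r, hx', hy', h⟩
  rcases le_total r s with hrs | hrs
  exacts [((hf hrs).2 _ hx' _ hy').1 h, ((hf hrs).2 _ hx _ hy).2 h]

/-- Each member of an increasing sequence of conditions is an induced subgraph of the limit. -/
def embeddingLimit (s : ℕ) : (f s).graph.induce (f s).verts ↪g limit f where
  toFun x := ⟨x, Set.mem_iUnion.2 ⟨s, x.2⟩⟩
  inj' _ _ h := Subtype.ext (congrArg Subtype.val h :)
  map_rel_iff' {x y} := limit_adj_iff hf x.2 y.2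

lemma exists_forall_mem {ι : Type*} [Finite ι] (a : ι → ⋃ s, (f s).verts) (r : ℕ) :
    ∃ s, r ≤ s ∧ ∀ i, (a i).1 ∈ (f s).verts := by
  choose s hs using fun i => Set.mem_iUnion.1 (a i).2
  obtain ⟨N, hN⟩ := (Set.finite_range s).bddAbove
  exact ⟨r ⊔ N, le_sup_left, fun i => (hf ((hN ⟨i, rfl⟩).trans le_sup_right)).1 (hs i)⟩

lemma free_limit [Finite W] : C.Free (limit f) := by
  rintro ⟨c⟩
  obtain ⟨s, -, hs⟩ := exists_forall_mem hf c 0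
  refine (f s).free ⟨⟨⟨fun w => ⟨c w, hs w⟩, fun {a b} hab => ?_⟩, fun a b hab => ?_⟩⟩
  · exact (limit_adj_iff hf (hs a) (hs b)).1 (c.toHom.map_adj hab)
  · exact c.injective (Subtype.ext (congrArg Subtype.val hab :))

lemma pattern_limit {ι : Type*} {t : ι → ⋃ s, (f s).verts} {s : ℕ}
    (ht : ∀ i, (t i).1 ∈ (f s).verts) :
    pattern (limit f) t = pattern (f s).graph fun i => (t i).1 :=
  pattern_eq_iff.2 fun i j => ⟨Subtype.ext_iff, limit_adj_iff hf (ht i) (ht j)⟩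

/-- A pattern occurring in a `C`-free graph above the limit cannot have been decided negatively,
because every condition in the sequence has an extension that realizes it. -/
lemma reflectsPatterns_limit
    (hgen : ∀ (m k : ℕ) (a : Fin m → X) (P : Pattern (Fin m ⊕ Fin k)),
      ∃ s, f s ∈ realizing C a P ∨ ∀ q, f s ≤ q → q ∉ realizing C a P) :
    ReflectsPatterns C (limit f) := by
  intro V H e hH m k a y
  obtain ⟨s, hs⟩ := hgen m k (fun i => (a i).1) (pattern H (Sum.elim (e ∘ a) y))
  obtain ⟨r, hsr, ha⟩ := exists_forall_mem hf a s
  rcases hs with ⟨has, z, hz, hpat⟩ | hs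
  · refine ⟨fun j => ⟨z j, Set.mem_iUnion.2 ⟨s, hz j⟩⟩, Eq.trans ?_ hpat⟩
    rw [pattern_limit hf (s := s) (Sum.forall.2 ⟨has, hz⟩)]
    exact congrArg _ (funext <| Sum.forall.2 ⟨fun _ => rfl, fun _ => rfl⟩)
  · let e' := e.comp (embeddingLimit hf r)
    obtain ⟨q, g, hrq, hg, g_old, hgq⟩ := (f r).exists_extension e' hH.2 (Set.finite_range y)
    refine absurd ⟨fun i => hrq.1 (ha i), g ∘ y, fun j => hgq _ (Or.inr ⟨j, rfl⟩), ?_⟩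
      (hs q ((hf hsr).trans hrq))
    have hcomp : Sum.elim (fun i => (a i).1) (g ∘ y) = g ∘ Sum.elim (e ∘ a) y := by
      rw [Sum.comp_elim]
      exact congrArg₂ _ (funext fun i => (g_old ⟨a i, ha i⟩).symm) rfl
    rw [hcomp]
    refine hg.pattern_eq ?_
    rintro (i | j)
    exacts [Or.inl ⟨⟨a i, ha i⟩, rfl⟩, Or.inr ⟨j, rfl⟩]

end Limit

end PartialGraph

theorem exists_isExistentiallyComplete_embedding {W : Type v} [Finite W] {C : SimpleGraph W}
    {V : Type u} {G : SimpleGraph V} (hG : IsCountableFree C G) :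
    ∃ (V' : Type u) (H : SimpleGraph V'), IsExistentiallyComplete C H ∧ Nonempty (G ↪g H) := by
  have := hG.1
  let p : PartialGraph C (V ⊕ ℕ) := .ofEmbedding hG.2 ⟨Sum.inl, Sum.inl_injective⟩ <|
    (Set.infinite_range_of_injective (Sum.inr_injective (α := V) (β := ℕ))).mono <| by
      rintro _ ⟨i, rfl⟩ ⟨v, h⟩
      cases h
  obtain ⟨f, hf0, hf, hgen⟩ := p.exists_generic
  have hp : G ↪g (f 0).graph.induce (f 0).verts := by
    rw [hf0]
    exact ⟨⟨fun v => ⟨Sum.inl v, v, rfl⟩, fun v w h => Sum.inl_injective (Subtype.ext_iff.1 h)⟩,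
      fun {v w} => SimpleGraph.map_adj_apply (f := ⟨Sum.inl, Sum.inl_injective⟩)⟩
  exact ⟨_, PartialGraph.limit f, isExistentiallyComplete_iff.2
    ⟨⟨inferInstance, PartialGraph.free_limit hf⟩, PartialGraph.reflectsPatterns_limit hf hgen⟩,
    ⟨(PartialGraph.embeddingLimit hf 0).comp hp⟩⟩

theorem exists_isExistentiallyComplete {W : Type v} [Finite W] [Nonempty W] (C : SimpleGraph W) :
    ∃ (V : Type u) (G : SimpleGraph V), IsExistentiallyComplete C G := by
  have hfree : IsCountableFree C (⊥ : SimpleGraph PEmpty.{u + 1}) :=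
    ⟨inferInstance, fun ⟨c⟩ => (c (Classical.arbitrary W)).elim⟩
  obtain ⟨V, G, hG, -⟩ := exists_isExistentiallyComplete_embedding hfree
  exact ⟨V, G, hG⟩

/-! ### Ultrapowers -/

section Ultrapower

open Filter

variable {α V V₁ V₂ : Type*} {l : Ultrafilter α} {G : SimpleGraph V} {G₁ : SimpleGraph V₁}
  {G₂ : SimpleGraph V₂}

/-- The ultrapower of `G` along `l`, with the germs along `l` as vertices. -/
def germGraph (l : Ultrafilter α) (G : SimpleGraph V) : SimpleGraph (Germ (l : Filter α) V) where
  Adj := Germ.LiftRel G.Adj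
  symm := ⟨fun x y => Germ.inductionOn₂ x y fun f g h => by
    rw [Germ.liftRel_coe] at h ⊢
    exact h.mono fun _ h => h.symm⟩
  loopless := ⟨fun x => Germ.inductionOn x fun f h => by
    rw [Germ.liftRel_coe] at h
    obtain ⟨_, h⟩ := h.exists
    exact h.ne rfl⟩

lemma eventually_iff_eventually (l : Ultrafilter α) (P : α → Prop) :
    ∀ᶠ x in l, (P x ↔ ∀ᶠ y in l, P y) := by
  by_cases h : ∀ᶠ y in l, P y
  · exact h.mono fun x hx => ⟨fun _ => h, fun _ => hx⟩
  · exact (Ultrafilter.eventually_not.2 h).mono fun x hx => iff_of_false hx h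

lemma eventually_pattern_eq {ι : Type*} [Finite ι] (l : Ultrafilter α) (G : SimpleGraph V)
    (s : ι → α → V) : ∀ᶠ x in l, pattern G (fun i => s i x) =
      pattern (germGraph l G) (fun i => (s i : Germ (l : Filter α) V)) := by
  simp only [pattern_eq_iff, eventually_all, Germ.coe_eq]
  exact fun i j => (eventually_iff_eventually l fun x => s i x = s j x).and
    (eventually_iff_eventually l fun x => G.Adj (s i x) (s j x))

lemma free_germGraph {W : Type*} [Finite W] {C : SimpleGraph W} (l : Ultrafilter α)
    (hG : C.Free G) : C.Free (germGraph l G) := by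
  rintro ⟨c⟩
  choose s hs using fun w => Quotient.exists_rep (c w)
  change ∀ w, (s w : Germ (l : Filter α) V) = c w at hs
  obtain ⟨x, hx⟩ := (eventually_pattern_eq l G s).exists
  simp only [pattern_eq_iff, hs] at hx
  exact hG ⟨⟨⟨fun w => s w x, fun {a b} hab => (hx a b).2.2 (c.toHom.map_adj hab)⟩,
    fun a b hab => c.injective ((hx a b).1.1 hab)⟩⟩

lemma exists_embedding_germGraph {g : α → V₁ → V₂}
    (hg : ∀ v w, ∀ᶠ x in (l : Filter α), IsEmbeddingOn G₁ G₂ {v, w} (g x)) :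
    ∃ e : G₁ ↪g germGraph l G₂,
      ∀ v, e v = ((fun x => g x v : α → V₂) : Germ (l : Filter α) V₂) := by
  refine ⟨⟨⟨fun v => ((fun x => g x v : α → V₂) : Germ (l : Filter α) V₂), fun v w hvw => ?_⟩,
    fun {v w} => ?_⟩, fun _ => rfl⟩
  · obtain ⟨x, hx, hxvw⟩ := ((hg v w).and (Germ.coe_eq.1 hvw)).exists
    exact hx.1 (by simp) (by simp) hxvw
  · exact (eventually_congr ((hg v w).mono fun x hx => hx.2 v (by simp) w (by simp))).trans
      eventually_const

end Ultrapower

section Reflection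

variable {V₁ V₂ : Type u} {G₁ : SimpleGraph V₁} {G₂ : SimpleGraph V₂}

/-- `g` embeds `A` in `G₂` in such a way that every configuration of `k` vertices of `G₂` over the
image of `A` already occurs over `A` in `G₁`. -/
def IsReflecting (G₁ : SimpleGraph V₁) (G₂ : SimpleGraph V₂) (k : ℕ) (A : Set V₁) (g : V₁ → V₂) :
    Prop :=
  IsEmbeddingOn G₁ G₂ A g ∧ ∀ y : Fin k → V₂, ∃ h : V₂ → V₁,
    IsEmbeddingOn G₂ G₁ (g '' A ∪ Set.range y) h ∧ ∀ a ∈ A, h (g a) = a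

lemma exists_fin_subset_range {α : Type*} [Nonempty α] {Y : Finset α} {k : ℕ}
    (hk : Y.card ≤ k) : ∃ y : Fin k → α, ↑Y ⊆ Set.range y := by
  have e : Y ↪ Fin k := (Function.Embedding.nonempty_of_card_le (by simpa using hk)).some
  exact ⟨Function.extend e Subtype.val fun _ => Classical.arbitrary α,
    fun a ha => ⟨e ⟨a, ha⟩, e.injective.extend_apply _ _ _⟩⟩

lemma IsReflecting.exists_retraction [Nonempty V₂] {k : ℕ} {A : Set V₁} {g : V₁ → V₂}
    (hg : IsReflecting G₁ G₂ k A g) {Y : Finset V₂} (hY : Y.card ≤ k) :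
    ∃ h : V₂ → V₁, IsEmbeddingOn G₂ G₁ (g '' A ∪ Y) h ∧ ∀ a ∈ A, h (g a) = a := by
  obtain ⟨y, hy⟩ := exists_fin_subset_range hY
  obtain ⟨h, hh, hfix⟩ := hg.2 y
  exact ⟨h, hh.mono (Set.union_subset_union_right _ hy), hfix⟩

open Filter in
/-- If embeddings of larger and larger finite parts of `G₁` failed to be reflecting, an ultraproduct
of them would embed `G₁` in an ultrapower of `G₂` in which the failure persists, against the
existential completeness of `G₁`. -/
theorem IsExistentiallyComplete.exists_finset_isReflecting {W : Type v} [Finite W]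
    {C : SimpleGraph W} [Nonempty V₁] (h₁ : IsExistentiallyComplete C G₁) (h₂ : C.Free G₂)
    (A : Finset V₁) (k : ℕ) : ∃ F : Finset V₁,
      ∀ g : V₁ → V₂, IsEmbeddingOn G₁ G₂ F g → IsReflecting G₁ G₂ k A g := by
  classical
  by_contra! hcon
  have hcon' (F : Finset V₁) : ∃ (g : V₁ → V₂) (y : Fin k → V₂), IsEmbeddingOn G₁ G₂ F g ∧
      ¬ ∃ h : V₂ → V₁, IsEmbeddingOn G₂ G₁ (g '' A ∪ Set.range y) h ∧ ∀ a ∈ A, h (g a) = a := by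
    obtain ⟨g, hg, hgA⟩ := hcon (F ∪ A)
    have hgF := hg.mono (Finset.coe_subset.2 Finset.subset_union_left)
    simp only [IsReflecting, hg.mono (Finset.coe_subset.2 Finset.subset_union_right), true_and,
      not_forall] at hgA
    obtain ⟨y, hy⟩ := hgA
    exact ⟨g, y, hgF, hy⟩
  choose g y hg hy using hcon'
  let l : Ultrafilter (Finset V₁) := Ultrafilter.of atTop
  have eventually_isEmbeddingOn (v w : V₁) :
      ∀ᶠ F in (l : Filter (Finset V₁)), IsEmbeddingOn G₁ G₂ {v, w} (g F) :=
    ((eventually_ge_atTop {v, w}).filter_mono (Ultrafilter.of_le atTop)).mono fun F hF =>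
      (hg F).mono (by simpa only [Finset.coe_pair] using Finset.coe_subset.2 hF)
  obtain ⟨e, he⟩ := exists_embedding_germGraph eventually_isEmbeddingOn
  obtain ⟨y', hy'⟩ := h₁.exists_pattern_eq e (free_germGraph l h₂) (Subtype.val : A → V₁)
    fun j => ((fun F => y F j : Finset V₁ → V₂) : Germ (l : Filter (Finset V₁)) V₂)
  obtain ⟨F, hF⟩ := (eventually_pattern_eq l G₂
    (Sum.elim (fun (a : A) F => g F a) fun j F => y F j)).exists
  have hpat : pattern G₁ (Sum.elim Subtype.val y') =
      pattern G₂ (Sum.elim (fun a : A => g F a) (y F)) := by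
    convert hy'.trans (Eq.trans ?_ hF.symm) using 2
    · exact funext (Sum.forall.2 ⟨fun _ => rfl, fun _ => rfl⟩)
    · exact congrArg _ (funext (Sum.forall.2 ⟨fun a => he a, fun _ => rfl⟩))
  obtain ⟨h, hh, hval⟩ := exists_isEmbeddingOn_of_pattern_eq hpat
  refine hy F ⟨h, ?_, fun a ha => hval (Sum.inl ⟨a, ha⟩)⟩
  rwa [Set.image_eq_range, ← Set.Sum.elim_range]

end Reflection

/-! ### Back and forth between closed sets -/

theorem exists_equiv_of_back_and_forth {α β : Type*} [Countable α] [Countable β]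
    {R : Set (α × β) → Prop} {p : Set (α × β)} (hp : R p)
    (hR : ∀ p, R p → ∀ x ∈ p, ∀ y ∈ p, (x.1 = y.1 ↔ x.2 = y.2))
    (forth : ∀ p, R p → ∀ a, ∃ q, R q ∧ p ⊆ q ∧ ∃ b, (a, b) ∈ q)
    (back : ∀ p, R p → ∀ b, ∃ q, R q ∧ p ⊆ q ∧ ∃ a, (a, b) ∈ q) :
    ∃ e : α ≃ β, (∀ x ∈ p, e x.1 = x.2) ∧
      ∀ s : Set α, s.Finite → ∃ q, R q ∧ ∀ a ∈ s, (a, e a) ∈ q := by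
  let D : α ⊕ β → Order.Cofinal {p // R p} := Sum.elim
    (fun a => ⟨{q | ∃ b, (a, b) ∈ q.1}, fun ⟨q, hq⟩ =>
      (forth q hq a).elim fun r ⟨hr, hqr, hb⟩ => ⟨⟨r, hr⟩, hb, hqr⟩⟩)
    (fun b => ⟨{q | ∃ a, (a, b) ∈ q.1}, fun ⟨q, hq⟩ =>
      (back q hq b).elim fun r ⟨hr, hqr, ha⟩ => ⟨⟨r, hr⟩, ha, hqr⟩⟩)
  obtain ⟨f, hf0, hf, hD⟩ := exists_monotone_forall_mem ⟨p, hp⟩ D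
  have eq_iff {x y : α × β} {s t : ℕ} (hx : x ∈ (f s).1) (hy : y ∈ (f t).1) :
      x.1 = y.1 ↔ x.2 = y.2 :=
    hR _ (f (s ⊔ t)).2 x (hf le_sup_left hx) y (hf le_sup_right hy)
  choose s φ hφ using fun a => hD (Sum.inl a)
  choose t ψ hψ using fun b => hD (Sum.inr b)
  let e : α ≃ β := ⟨φ, ψ, fun a => (eq_iff (hψ _) (hφ a)).2 rfl, fun b =>
    (eq_iff (hφ _) (hψ b)).1 rfl⟩
  refine ⟨e, fun x hx => ?_, fun S hS => ?_⟩
  · exact (eq_iff (hφ x.1) (show x ∈ (f 0).1 by rwa [hf0])).1 rfl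
  · obtain ⟨N, hN⟩ := (hS.image s).bddAbove
    exact ⟨_, (f N).2, fun a ha => hf (hN ⟨a, ha, rfl⟩) (hφ a)⟩

section BackAndForth

variable {n : ℕ} {V₁ V₂ : Type u} {G₁ : SimpleGraph V₁} {G₂ : SimpleGraph V₂}

lemma exists_finset_forall_isKernel (G : SimpleGraph V₁) (n : ℕ) (A : Finset V₁) :
    ∃ F : Finset V₁, A ⊆ F ∧ ∀ B ⊆ A, IsKernel G n B → ∃ x ∈ F, ∃ y ∈ F, x ≠ y ∧
      (∀ v ∈ B, G.Adj x v) ∧ ∀ v ∈ B, G.Adj y v := by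
  classical
  have (B : Finset V₁) : ∃ E : Finset V₁, IsKernel G n B → ∃ x ∈ E, ∃ y ∈ E, x ≠ y ∧
      (∀ v ∈ B, G.Adj x v) ∧ ∀ v ∈ B, G.Adj y v := by
    by_cases hB : IsKernel G n B
    · obtain ⟨-, -, x, y, h⟩ := hB
      exact ⟨{x, y}, fun _ => ⟨x, by simp, y, by simp, h⟩⟩
    · exact ⟨∅, fun h => absurd h hB⟩
  choose E hE using this
  refine ⟨A ∪ A.powerset.biUnion E, Finset.subset_union_left, fun B hBA hB => ?_⟩
  have hEB : E B ⊆ A ∪ A.powerset.biUnion E :=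
    (Finset.subset_biUnion_of_mem E (Finset.mem_powerset.2 hBA)).trans Finset.subset_union_right
  obtain ⟨x, hx, y, hy, h⟩ := hE B hB
  exact ⟨x, hEB hx, y, hEB hy, h⟩

namespace IsReflecting

variable {A : Set V₁} {g : V₁ → V₂} {k : ℕ}

lemma isKernel_of_isKernel_image [DecidableEq V₂] (hg : IsReflecting G₁ G₂ k A g) (hk : 2 ≤ k)
    {B : Finset V₁} (hBA : ↑B ⊆ A) (hB : IsKernel G₂ n (B.image g)) : IsKernel G₁ n B := by
  classical
  obtain ⟨hcl, hc, x, y, hxy, hx, hy⟩ := hB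
  have : Nonempty V₂ := ⟨x⟩
  obtain ⟨h, hh, hfix⟩ := hg.exists_retraction (Y := {x, y}) (Finset.card_le_two.trans hk)
  have hBS : ↑(B.image g) ⊆ g '' A ∪ ↑({x, y} : Finset V₂) := by
    rw [Finset.coe_image]
    exact (Set.image_mono hBA).trans Set.subset_union_left
  have hker := hh.isKernel_image hcl hc hBS hxy (Or.inr (by simp)) (Or.inr (by simp)) hx hy
  have himage : (B.image g).image h = B := by
    rw [Finset.image_image]
    exact (Finset.image_congr fun b hb => hfix b (hBA hb)).trans Finset.image_id
  rwa [himage] at hker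

/-- The retraction of `Q` to `G₁` is contained in `a*`: otherwise `a*` would contain a kernel inside
it, whose image is a kernel inside `Q`. -/
lemma subset_image_of_isIsolatedClique [DecidableEq V₂] (hg : IsReflecting G₁ G₂ k A g)
    (hn : 2 ≤ n) (hk : n ≤ k) (h₁ : CliqueTriangleFree n G₁) (hA : ∀ a ∈ A, star G₁ n a ⊆ A)
    (hker : ∀ B : Finset V₁, ↑B ⊆ A → IsKernel G₁ n B → IsKernel G₂ n (B.image g)) {a : V₁}
    (ha : a ∈ A) {Q : Finset V₂} (hQ : IsIsolatedClique G₂ n Q) (haQ : g a ∈ Q) :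
    ↑Q ⊆ g '' A := by
  classical
  have : Nonempty V₂ := ⟨g a⟩
  obtain ⟨h, hh, hfix⟩ := hg.exists_retraction (hQ.1.card_eq.trans_le hk)
  have map_eq : ∀ z ∈ Q, h z ∈ A → g (h z) = z := fun z hz hzA =>
    hh.1 (Or.inl ⟨_, hzA, rfl⟩) (Or.inr hz) (hfix _ hzA)
  have hQ' : G₁.IsNClique n (Q.image h) := hh.isNClique_image hQ.1 Set.subset_union_right
  have haQ' : a ∈ Q.image h := Finset.mem_image.2 ⟨g a, haQ, hfix a ha⟩
  have hsub : ↑(Q.image h) ⊆ star G₁ n a := by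
    by_contra hsub
    obtain ⟨D, hDQ, hD, hDs⟩ := h₁.exists_isKernel_of_not_subset_star hn hQ' haQ' hsub
    have hDA : ↑D ⊆ A := hDs.trans (hA a ha)
    refine hQ.not_isKernel_subset hn (hker D hDA hD) fun z hz => ?_
    obtain ⟨c, hc, rfl⟩ := Finset.mem_image.1 hz
    obtain ⟨w, hw, rfl⟩ := Finset.mem_image.1 (hDQ hc)
    rwa [map_eq w hw (hDA hc)]
  intro b hb
  have hbA : h b ∈ A := hA a ha (hsub (Finset.mem_image_of_mem h hb))
  exact ⟨h b, hbA, map_eq b hb hbA⟩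

lemma subset_image_of_isKernel (hg : IsReflecting G₁ G₂ k A g) (hk : n + 1 ≤ k)
    (hA : ∀ a ∈ A, star G₁ n a ⊆ A) {a : V₁} (ha : a ∈ A) {B : Finset V₂} (hB : IsKernel G₂ n B)
    (hclq : G₂.IsClique (insert (g a) (B : Set V₂))) : ↑B ⊆ g '' A := by
  classical
  have : Nonempty V₂ := ⟨g a⟩
  obtain ⟨hcl, hc, x, y, hxy, hx, hy⟩ := hB
  obtain ⟨h, hh, hfix⟩ := hg.exists_retraction (Y := insert x (insert y B)) <|
    (Finset.card_insert_le _ _).trans (by have := Finset.card_insert_le y B; omega)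
  have hBS : (B : Set V₂) ⊆ g '' A ∪ ↑(insert x (insert y B)) := fun z hz =>
    Or.inr (by simp [Finset.mem_coe.1 hz])
  have hB' := hh.isKernel_image hcl hc hBS hxy (Or.inr (by simp)) (Or.inr (by simp)) hx hy
  have hclq' := hh.isClique_image hclq (Set.insert_subset (Or.inl ⟨a, ha, rfl⟩) hBS)
  rw [Set.image_insert_eq, hfix a ha, ← Finset.coe_image] at hclq'
  intro b hb
  have hbA : h b ∈ A :=
    hA a ha ⟨B.image h, isSpecial_iff.2 (Or.inr hB'), hclq', Finset.mem_image_of_mem h hb⟩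
  exact ⟨h b, hbA, hh.1 (Or.inl ⟨_, hbA, rfl⟩) (hBS hb) (hfix _ hbA)⟩

lemma isClosedPartialIso_graph [DecidableEq V₂] (hg : IsReflecting G₁ G₂ k A g) (hn : 2 ≤ n)
    (hk : n + 1 ≤ k) (h₁ : CliqueTriangleFree n G₁) (hA : ∀ a ∈ A, star G₁ n a ⊆ A)
    (hker : ∀ B : Finset V₁, ↑B ⊆ A → IsKernel G₁ n B → IsKernel G₂ n (B.image g)) :
    IsClosedPartialIso n G₁ G₂ ((fun a => (a, g a)) '' A) where
  eq_iff := by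
    rintro _ ⟨x, hx, rfl⟩ _ ⟨y, hy, rfl⟩
    exact (hg.1.1.eq_iff hx hy).symm
  adj_iff := by
    rintro _ ⟨x, hx, rfl⟩ _ ⟨y, hy, rfl⟩
    exact (hg.1.2 x hx y hy).symm
  left := by
    rintro _ ⟨x, hx, rfl⟩ a ha
    exact ⟨g a, a, hA x hx ha, rfl⟩
  right := by
    rintro _ ⟨a, ha, rfl⟩ b ⟨B, hB, hclq, hb⟩
    have hBA : ↑B ⊆ g '' A := by
      rcases isSpecial_iff.1 hB with hB | hB
      · exact hg.subset_image_of_isIsolatedClique hn (by omega) h₁ hA hker ha hB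
          (hB.mem_of_isClique_insert hn hclq)
      · exact hg.subset_image_of_isKernel hk hA ha hB hclq
    obtain ⟨c, hc, rfl⟩ := hBA hb
    exact ⟨c, c, hc, rfl⟩
  isKernel_iff B D hB hD := by
    have hBA : ↑B ⊆ A := fun b hb => by
      obtain ⟨d, -, c, hc, ⟨⟩⟩ := hB b hb
      exact hc
    obtain rfl : D = B.image g := by
      refine Finset.Subset.antisymm (fun d hd => ?_) (Finset.image_subset_iff.2 fun b hb => ?_)
      · obtain ⟨b, hb, c, -, ⟨⟩⟩ := hD d hd
        exact Finset.mem_image_of_mem g hb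
      · obtain ⟨d, hd, c, -, ⟨⟩⟩ := hB b hb
        exact hd
    exact ⟨hker B hBA, hg.isKernel_of_isKernel_image (by omega) hBA⟩

end IsReflecting

/-- The type of a finite closed set is isolated by an existential formula. -/
theorem IsExistentiallyComplete.exists_finset_isClosedPartialIso [Nonempty V₁] (hn : 3 ≤ n)
    (h₁ : IsExistentiallyComplete (cliqueWithTriangle n) G₁)
    (h₂ : (cliqueWithTriangle n).Free G₂) {A : Finset V₁} (hA : ∀ a ∈ A, star G₁ n a ⊆ A) :
    ∃ F : Finset V₁, ∀ g : V₁ → V₂, IsEmbeddingOn G₁ G₂ F g →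
      IsClosedPartialIso n G₁ G₂ ((fun a => (a, g a)) '' A) := by
  classical
  obtain ⟨E, hAE, hE⟩ := exists_finset_forall_isKernel G₁ n A
  obtain ⟨F, hF⟩ := h₁.exists_finset_isReflecting h₂ A (n + 1)
  refine ⟨E ∪ F, fun g hg => ?_⟩
  have hgE := hg.mono (Finset.coe_subset.2 Finset.subset_union_left)
  have hgF := hg.mono (Finset.coe_subset.2 Finset.subset_union_right)
  refine (hF g hgF).isClosedPartialIso_graph (by omega) le_rfl (h₁.cliqueTriangleFree (by omega))
    hA fun B hBA hB => ?_
  obtain ⟨x, hxE, y, hyE, hxy, hx, hy⟩ := hE B (Finset.coe_subset.1 hBA) hB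
  exact hgE.isKernel_image hB.1 hB.2.1 (hBA.trans (Finset.coe_subset.2 hAE)) hxy hxE hyE hx hy

lemma IsExistentiallyComplete.exists_isEmbeddingOn_extending [Nonempty V₂] (hn : 3 ≤ n)
    (h₁ : IsExistentiallyComplete (cliqueWithTriangle n) G₁)
    (h₂ : IsExistentiallyComplete (cliqueWithTriangle n) G₂) {p : Set (V₁ × V₂)}
    (hp : IsClosedPartialIso n G₁ G₂ p) (hfin : p.Finite) {F : Set V₁} (hF : F.Finite) :
    ∃ g : V₁ → V₂, IsEmbeddingOn G₁ G₂ F g ∧ ∀ x ∈ p, g x.1 = x.2 := by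
  obtain ⟨W, H, e₁, e₂, hH⟩ := hp.exists_isFreeAmalgam
  have hfree := hH.cliqueTriangleFree hn (h₁.cliqueTriangleFree (by omega))
    (h₂.cliqueTriangleFree (by omega)) hp
  obtain ⟨h, hh, hfix⟩ := h₂.exists_retraction e₂ (free_of_cliqueTriangleFree (by omega) hfree)
    ((hF.image e₁).union ((hfin.image Prod.snd).image e₂))
  refine ⟨h ∘ e₁, ⟨?_, fun x hx y hy => ?_⟩, fun x hx => ?_⟩
  · exact (hh.1.mono Set.subset_union_left).comp e₁.injective.injOn (Set.mapsTo_image e₁ F)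
  · rw [← e₁.map_adj_iff (v := x)]
    exact hh.2 _ (Or.inl ⟨x, hx, rfl⟩) _ (Or.inl ⟨y, hy, rfl⟩)
  · rw [Function.comp_apply, (hH.eq_iff x.1 x.2).2 hx]
    exact hfix _ (Or.inr ⟨_, ⟨x, hx, rfl⟩, rfl⟩)

lemma IsClosedPartialIso.exists_finset_closure (hn : 3 ≤ n)
    (h₁ : CliqueTriangleFree n G₁) {p : Set (V₁ × V₂)} (hp : IsClosedPartialIso n G₁ G₂ p)
    (hfin : p.Finite) (b : V₁) : ∃ A : Finset V₁, (∀ a ∈ A, star G₁ n a ⊆ A) ∧ b ∈ A ∧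
      ∀ x ∈ p, x.1 ∈ A := by
  have hfin' := (hfin.image Prod.fst).union ((h₁.finite_star hn b).insert b)
  refine ⟨hfin'.toFinset, ?_, by simp, fun x hx => ?_⟩
  · simp only [Set.Finite.mem_toFinset, Set.Finite.coe_toFinset]
    rintro _ (⟨x, hx, rfl⟩ | rfl | ha) c hc
    · obtain ⟨d, hd⟩ := hp.left x hx c hc
      exact Or.inl ⟨_, hd, rfl⟩
    · exact Or.inr (Or.inr hc)
    · exact Or.inr (Or.inr (h₁.star_subset_of_mem hn ha hc))
  · exact hfin'.mem_toFinset.2 (Or.inl ⟨x, hx, rfl⟩)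

theorem IsClosedPartialIso.exists_extension [Nonempty V₁] [Nonempty V₂] (hn : 3 ≤ n)
    (h₁ : IsExistentiallyComplete (cliqueWithTriangle n) G₁)
    (h₂ : IsExistentiallyComplete (cliqueWithTriangle n) G₂) {p : Set (V₁ × V₂)}
    (hp : IsClosedPartialIso n G₁ G₂ p) (hfin : p.Finite) (b : V₁) :
    ∃ q, (IsClosedPartialIso n G₁ G₂ q ∧ q.Finite) ∧ p ⊆ q ∧ ∃ d, (b, d) ∈ q := by
  classical
  obtain ⟨A, hA, hbA, hpA⟩ :=
    hp.exists_finset_closure hn (h₁.cliqueTriangleFree (by omega)) hfin b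
  obtain ⟨F, hF⟩ := h₁.exists_finset_isClosedPartialIso hn h₂.free hA
  obtain ⟨g, hg, hgp⟩ := h₁.exists_isEmbeddingOn_extending hn h₂ hp hfin F.finite_toSet
  exact ⟨_, ⟨hF g hg, A.finite_toSet.image _⟩,
    fun x hx => ⟨x.1, hpA x hx, Prod.ext rfl (hgp x hx)⟩, g b, b, hbA, rfl⟩

theorem IsClosedPartialIso.exists_iso (hn : 3 ≤ n)
    (h₁ : IsExistentiallyComplete (cliqueWithTriangle n) G₁)
    (h₂ : IsExistentiallyComplete (cliqueWithTriangle n) G₂) {p : Set (V₁ × V₂)}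
    (hp : IsClosedPartialIso n G₁ G₂ p) (hfin : p.Finite) :
    ∃ e : G₁ ≃g G₂, ∀ x ∈ p, e x.1 = x.2 := by
  have := h₁.countable
  have := h₂.countable
  have := h₁.nonempty
  have := h₂.nonempty
  obtain ⟨e, he, hfin⟩ := exists_equiv_of_back_and_forth
    (R := fun q => IsClosedPartialIso n G₁ G₂ q ∧ q.Finite) ⟨hp, hfin⟩
    (fun q hq => hq.1.eq_iff) (fun q hq => hq.1.exists_extension hn h₁ h₂ hq.2) fun q hq b => by
      obtain ⟨r, hr, hqr, a, ha⟩ := hq.1.symm.exists_extension hn h₂ h₁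
        (hq.2.preimage Prod.swap_injective.injOn) b
      exact ⟨_, ⟨hr.1.symm, hr.2.preimage Prod.swap_injective.injOn⟩,
        fun x hx => hqr (a := x.swap) hx, a, ha⟩
  refine ⟨⟨e, fun {a b} => ?_⟩, he⟩
  obtain ⟨q, hq, hmem⟩ := hfin {a, b} (Set.toFinite _)
  exact (hq.1.adj_iff _ (hmem a (by simp)) _ (hmem b (by simp))).symm

lemma isClosedPartialIso_empty (hn : 2 ≤ n) : IsClosedPartialIso n G₁ G₂ ∅ where
  eq_iff := by simp
  adj_iff := by simp
  left := by simp
  right := by simp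
  isKernel_iff B D hB hD := by
    obtain rfl : B = ∅ := Finset.eq_empty_of_forall_notMem fun b hb => by simpa using hB b hb
    obtain rfl : D = ∅ := Finset.eq_empty_of_forall_notMem fun b hb => by simpa using hD b hb
    constructor <;> rintro ⟨-, h, -⟩ <;> simp at h <;> omega

theorem IsExistentiallyComplete.nonempty_iso (hn : 3 ≤ n)
    (h₁ : IsExistentiallyComplete (cliqueWithTriangle n) G₁)
    (h₂ : IsExistentiallyComplete (cliqueWithTriangle n) G₂) : Nonempty (G₁ ≃g G₂) :=
  have ⟨e, _⟩ := (isClosedPartialIso_empty (by omega)).exists_iso hn h₁ h₂ Set.finite_empty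
  ⟨e⟩

end BackAndForth

/-! ### Countable models of a theory with finitely many types -/

section Types

variable {L : Language} {T : L.Theory} {M N α β : Type*} [L.Structure M] [L.Structure N]

lemma realize_iAlls_relabel_inr [Finite α] {φ : L.Formula α} :
    M ⊨ ((φ.relabel (Sum.inr : α → Empty ⊕ α)).iAlls α : L.Sentence) ↔
      ∀ t : α → M, φ.Realize t := by
  simp only [Language.Sentence.Realize, Language.Formula.realize_iAlls,
    Language.Formula.realize_relabel]
  rfl

lemma realize_iExs_relabel_cons {k : ℕ} {ψ : L.Formula (Fin (k + 1))} {t : Fin k → M} :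
    ((ψ.relabel (Fin.cons (Sum.inr ()) Sum.inl : Fin (k + 1) → Fin k ⊕ Unit)).iExs Unit).Realize
      t ↔ ∃ a, ψ.Realize (Fin.cons a t : Fin (k + 1) → M) := by
  have cons_eq (i : Unit → M) : Sum.elim t i ∘
      (Fin.cons (Sum.inr ()) Sum.inl : Fin (k + 1) → Fin k ⊕ Unit) = Fin.cons (i ()) t :=
    funext <| Fin.cases rfl fun _ => rfl
  simp only [Language.Formula.realize_iExs, Language.Formula.realize_relabel, cons_eq]
  exact (Equiv.funUnique Unit M).exists_congr fun _ => Iff.rfl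

variable [Nonempty M] [Nonempty N] [M ⊨ T] [N ⊨ T]

lemma forall_realize_of_isComplete (hT : T.IsComplete) [Finite α] {φ : L.Formula α}
    (h : ∀ t : α → M, φ.Realize t) (t : α → N) : φ.Realize t := by
  rw [← realize_iAlls_relabel_inr, hT.realize_sentence_iff] at h
  exact realize_iAlls_relabel_inr.1 (h.realize_sentence N) t

lemma typeOf_eq_iff {t : α → M} {s : α → N} :
    T.typeOf t = T.typeOf s ↔ ∀ φ : L.Formula α, φ.Realize t ↔ φ.Realize s := by
  rw [SetLike.ext_iff, ← Language.Formula.equivSentence.forall_congr_right]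
  simp only [Language.Theory.CompleteType.formula_mem_typeOf]

lemma typeOf_comp_eq {t : α → M} {s : α → N} (h : T.typeOf t = T.typeOf s) (ρ : β → α) :
    T.typeOf (t ∘ ρ) = T.typeOf (s ∘ ρ) := by
  rw [typeOf_eq_iff] at h ⊢
  exact fun φ => by simpa only [Language.Formula.realize_relabel] using h (φ.relabel ρ)

lemma eq_iff_of_typeOf_eq {t : α → M} {s : α → N} (h : T.typeOf t = T.typeOf s) (i j : α) :
    t i = t j ↔ s i = s j :=
  typeOf_eq_iff.1 h ((Language.Term.var i).equal (Language.Term.var j))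

lemma typeOf_eq_of_isEmpty (hT : T.IsComplete) [IsEmpty α] {t : α → M} {s : α → N} :
    T.typeOf t = T.typeOf s := by
  refine typeOf_eq_iff.2 fun φ => ⟨fun h => ?_, fun h => ?_⟩
  · exact forall_realize_of_isComplete hT (fun r => Subsingleton.elim t r ▸ h) s
  · exact forall_realize_of_isComplete hT (fun r => Subsingleton.elim s r ▸ h) t

lemma exists_formula_separating (t : α → M) (s : α → N) : ∃ φ : L.Formula α, φ.Realize t ∧
    (φ.Realize s → T.typeOf t = T.typeOf s) := by
  by_cases h : T.typeOf t = T.typeOf s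
  · exact ⟨⊤, Language.Formula.realize_top.2 trivial, fun _ => h⟩
  rw [typeOf_eq_iff, not_forall] at h
  obtain ⟨φ, hφ⟩ := h
  by_cases ht : φ.Realize t
  · exact ⟨φ, ht, fun hs => absurd (iff_of_true ht hs) hφ⟩
  · exact ⟨φ.not, ht, fun hs => absurd (iff_of_false ht hs) hφ⟩

lemma exists_formula_isolating (hT : T.IsComplete) [Finite α]
    (hfin : (T.realizedTypes M α).Finite) (t : α → M) : ∃ ψ : L.Formula α, ψ.Realize t ∧
      ∀ s : α → N, ψ.Realize s → T.typeOf t = T.typeOf s := by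
  choose φ hφ hsep using exists_formula_separating (T := T) (N := M) t
  have := hfin.to_subtype
  choose r hr using fun p : T.realizedTypes M α => p.2
  let ψ := Language.Formula.iInf fun p => φ (r p)
  have isolates (s : α → M) (hs : ψ.Realize s) : T.typeOf t = T.typeOf s := by
    have hrs := hr ⟨_, s, rfl⟩
    refine (hsep _ ?_).trans hrs
    exact (typeOf_eq_iff.1 hrs _).2 (Language.Formula.realize_iInf.1 hs _)
  refine ⟨ψ, Language.Formula.realize_iInf.2 fun p => hφ _, fun s hs => ?_⟩
  have transfer (χ : L.Formula α) (hχ : χ.Realize t) : χ.Realize s :=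
    (forall_realize_of_isComplete (M := M) (φ := ψ.imp χ) hT
      (fun r hr => (typeOf_eq_iff.1 (isolates r hr) χ).1 hχ) s) hs
  refine typeOf_eq_iff.2 fun χ => ⟨transfer χ, fun hχ => ?_⟩
  by_contra hχt
  exact transfer χ.not hχt hχ

lemma realizedTypes_subset (hT : T.IsComplete) [Finite α]
    (hfin : (T.realizedTypes M α).Finite) : T.realizedTypes N α ⊆ T.realizedTypes M α := by
  choose ψ hψ isolates using exists_formula_isolating (N := N) hT hfin
  have := hfin.to_subtype
  choose t ht using fun p : T.realizedTypes M α => p.2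
  have exhaust (s : α → M) : (Language.Formula.iSup fun p => ψ (t p)).Realize s :=
    Language.Formula.realize_iSup.2 ⟨⟨_, s, rfl⟩, (typeOf_eq_iff.1 (ht ⟨_, s, rfl⟩) _).1 (hψ _)⟩
  rintro _ ⟨s, rfl⟩
  obtain ⟨p, hp⟩ := Language.Formula.realize_iSup.1 (forall_realize_of_isComplete hT exhaust s)
  exact ⟨t p, isolates _ s hp⟩

lemma exists_typeOf_cons_eq (hT : T.IsComplete) {k : ℕ}
    (hfin : (T.realizedTypes M (Fin (k + 1))).Finite) {t : Fin k → M} {s : Fin k → N}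
    (h : T.typeOf t = T.typeOf s) (a : M) :
    ∃ b, T.typeOf (Fin.cons a t : Fin (k + 1) → M) = T.typeOf (Fin.cons b s : Fin (k + 1) → N) := by
  obtain ⟨ψ, hψ, isolates⟩ := exists_formula_isolating (N := N) hT hfin (Fin.cons a t)
  have hχ := (typeOf_eq_iff.1 h _).1 (realize_iExs_relabel_cons.2 ⟨a, hψ⟩)
  obtain ⟨b, hb⟩ := realize_iExs_relabel_cons.1 hχ
  exact ⟨b, isolates _ hb⟩

lemma nonempty_equiv_of_forall_typeOf_eq (e : M ≃ N)
    (he : ∀ (k : ℕ) (t : Fin k → M), T.typeOf t = T.typeOf (e ∘ t)) : Nonempty (M ≃[L] N) := by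
  refine ⟨⟨e, fun {k} f t => ?_, fun {k} r t => ?_⟩⟩
  · have := typeOf_eq_iff.1 (he (k + 1) (Fin.cons (Language.Structure.funMap f t) t))
      ((Language.Term.func f fun i => .var i.succ).equal (.var 0))
    simpa only [Language.Formula.realize_equal, Language.Term.realize_func,
      Language.Term.realize_var, Fin.cons_zero, Fin.cons_succ, Function.comp_def,
      Equiv.toFun_as_coe, true_iff, eq_comm (a := e _)] using this
  · have := typeOf_eq_iff.1 (he k t) (r.formula .var)
    simpa only [Language.Formula.realize_rel, Language.Term.realize_var,
      Equiv.toFun_as_coe] using this.symm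

/-- The uniqueness half of the Ryll-Nardzewski theorem. -/
theorem nonempty_equiv_of_isComplete (hT : T.IsComplete) [Countable M] [Countable N]
    (hfin : ∀ k, (T.realizedTypes M (Fin k)).Finite) : Nonempty (M ≃[L] N) := by
  let R (p : Set (M × N)) : Prop := ∃ (k : ℕ) (x : Fin k → M × N),
    T.typeOf (Prod.fst ∘ x) = T.typeOf (Prod.snd ∘ x) ∧ p = Set.range x
  have R_cons {k : ℕ} {x : Fin k → M × N} {a : M} {b : N}
      (h : T.typeOf (Fin.cons a (Prod.fst ∘ x) : Fin (k + 1) → M) =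
        T.typeOf (Fin.cons b (Prod.snd ∘ x) : Fin (k + 1) → N)) :
      R (insert (a, b) (Set.range x)) := by
    refine ⟨k + 1, Fin.cons (a, b) x, ?_, (Fin.range_cons _ _).symm⟩
    rwa [Fin.comp_cons, Fin.comp_cons]
  have hfin' (k : ℕ) : (T.realizedTypes N (Fin k)).Finite :=
    (hfin k).subset (realizedTypes_subset hT (hfin k))
  obtain ⟨e, -, he⟩ := exists_equiv_of_back_and_forth (R := R)
    ⟨0, Fin.elim0, typeOf_eq_of_isEmpty hT, rfl⟩
    (by
      rintro _ ⟨k, x, h, rfl⟩ _ ⟨i, rfl⟩ _ ⟨j, rfl⟩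
      exact eq_iff_of_typeOf_eq h i j)
    (by
      rintro _ ⟨k, x, h, rfl⟩ a
      obtain ⟨b, hb⟩ := exists_typeOf_cons_eq hT (hfin _) h a
      exact ⟨_, R_cons hb, Set.subset_insert _ _, b, Set.mem_insert _ _⟩)
    (by
      rintro _ ⟨k, x, h, rfl⟩ b
      obtain ⟨a, ha⟩ := exists_typeOf_cons_eq hT (hfin' _) h.symm b
      exact ⟨_, R_cons ha.symm, Set.subset_insert _ _, a, Set.mem_insert _ _⟩)
  refine nonempty_equiv_of_forall_typeOf_eq (T := T) e fun k t => ?_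
  obtain ⟨q, ⟨m, x, h, rfl⟩, hq⟩ := he (Set.range t) (Set.finite_range t)
  choose ρ hρ using fun i => hq (t i) ⟨i, rfl⟩
  have hfst : t = (Prod.fst ∘ x) ∘ ρ := funext fun i => (congr_arg Prod.fst (hρ i)).symm
  have hsnd : e ∘ t = (Prod.snd ∘ x) ∘ ρ := funext fun i => (congr_arg Prod.snd (hρ i)).symm
  rw [hsnd, hfst]
  exact typeOf_comp_eq h ρ

end Types

/-! ### Categoricity and universality -/

lemma isClosedPartialIso_range {n : ℕ} {V₁ V₂ ι : Type*} [Finite ι] {G₁ : SimpleGraph V₁}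
    {G₂ : SimpleGraph V₂} [DecidableEq V₁] [DecidableEq V₂] {r : ι → V₁} {s : ι → V₂}
    (hrs : pattern G₁ r = pattern G₂ s) (hr : ∀ i, star G₁ n (r i) ⊆ Set.range r)
    (hs : ∀ i, star G₂ n (s i) ⊆ Set.range s)
    (hker : ∀ I : Finset ι, IsKernel G₁ n (I.image r) ↔ IsKernel G₂ n (I.image s)) :
    IsClosedPartialIso n G₁ G₂ (Set.range fun i => (r i, s i)) where
  eq_iff := by
    rintro _ ⟨i, rfl⟩ _ ⟨j, rfl⟩
    exact (pattern_eq_iff.1 hrs i j).1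
  adj_iff := by
    rintro _ ⟨i, rfl⟩ _ ⟨j, rfl⟩
    exact (pattern_eq_iff.1 hrs i j).2
  left := by
    rintro _ ⟨i, rfl⟩ a ha
    obtain ⟨j, rfl⟩ := hr i ha
    exact ⟨s j, j, rfl⟩
  right := by
    rintro _ ⟨i, rfl⟩ b hb
    obtain ⟨j, rfl⟩ := hs i hb
    exact ⟨r j, j, rfl⟩
  isKernel_iff B D hB hD := by
    have hI := Set.toFinite {i | r i ∈ B ∧ s i ∈ D}
    have hB' : hI.toFinset.image r = B := by
      refine Finset.Subset.antisymm (Finset.image_subset_iff.2 fun i hi => ?_) fun b hb => ?_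
      · exact (hI.mem_toFinset.1 hi).1
      · obtain ⟨d, hd, i, ⟨⟩⟩ := hB b hb
        exact Finset.mem_image_of_mem r (hI.mem_toFinset.2 ⟨hb, hd⟩)
    have hD' : hI.toFinset.image s = D := by
      refine Finset.Subset.antisymm (Finset.image_subset_iff.2 fun i hi => ?_) fun d hd => ?_
      · exact (hI.mem_toFinset.1 hi).2
      · obtain ⟨b, hb, i, ⟨⟩⟩ := hD d hd
        exact Finset.mem_image_of_mem s (hI.mem_toFinset.2 ⟨hb, hd⟩)
    simpa only [hB', hD'] using hker hI.toFinset

section Categoricity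

variable {n : ℕ} {V W : Type u} {G : SimpleGraph V} {H : SimpleGraph W}

lemma exists_equiv_of_iso (e : G ≃g H) :
    let := G.structure; let := H.structure
    ∃ f : V ≃[Language.graph] W, ∀ x, f x = e x := by
  let := G.structure
  let := H.structure
  refine ⟨⟨e.toEquiv, fun f => isEmptyElim f, fun {k} r x => ?_⟩, fun _ => rfl⟩
  match k, r with
  | 2, .adj => exact e.map_adj_iff

lemma exists_fin_range_eq {α : Type*} {S : Set α} (hS : S.Nonempty) {k : ℕ}
    (hk : S.encard ≤ k) : ∃ y : Fin k → α, Set.range y = S := by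
  have := (Set.finite_of_encard_le_coe hk).fintype
  have := hS.to_subtype
  have e : S ↪ Fin k := (Function.Embedding.nonempty_of_card_le (by
    rwa [Fintype.card_fin, ← Set.toFinset_card, ← Nat.cast_le (α := ℕ∞),
      ← Set.encard_eq_coe_toFinset_card])).some
  refine ⟨Subtype.val ∘ Function.invFun e, ?_⟩
  rw [(Function.invFun_surjective e.injective).range_comp, Subtype.range_coe]

lemma CliqueTriangleFree.exists_range_closed (hG : CliqueTriangleFree n G) (hn : 3 ≤ n) (a : V) :
    ∃ c : Fin (n + 1) → V, a ∈ Set.range c ∧ ∀ j, star G n (c j) ⊆ Set.range c := by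
  obtain ⟨c, hc⟩ := exists_fin_range_eq (Set.insert_nonempty a (star G n a)) (k := n + 1)
    (by exact_mod_cast hG.encard_insert_star_le hn a)
  refine ⟨c, hc ▸ Set.mem_insert _ _, fun j => ?_⟩
  have hj : c j ∈ insert a (star G n a) := hc ▸ Set.mem_range_self j
  rw [hc]
  refine Set.Subset.trans ?_ (Set.subset_insert _ _)
  rcases hj with hj | hj
  · rw [hj]
  · exact hG.star_subset_of_mem hn hj

/-- Up to automorphism, a tuple of `k` vertices is determined by the pattern of its closure, which
has at most `k * (n + 1)` elements, and by the kernels in it. -/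
theorem IsExistentiallyComplete.finite_realizedTypes (hn : 3 ≤ n)
    (hG : IsExistentiallyComplete (cliqueWithTriangle n) G) (T : Language.graph.Theory) (k : ℕ) :
    let := G.structure
    ∀ [Nonempty V] [V ⊨ T], (T.realizedTypes V (Fin k)).Finite := by
  intro _ _ _
  classical
  choose c hc hstar using fun a => (hG.cliqueTriangleFree (by omega)).exists_range_closed hn a
  choose i₀ hi₀ using hc
  let r (t : Fin k → V) (x : Fin k × Fin (n + 1)) : V := c (t x.1) x.2
  have hr (t : Fin k → V) (x : Fin k × Fin (n + 1)) : star G n (r t x) ⊆ Set.range (r t) :=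
    (hstar (t x.1) x.2).trans (Set.range_subset_iff.2 fun j => ⟨(x.1, j), rfl⟩)
  let data (t : Fin k → V) : Pattern (Fin k × Fin (n + 1)) × Set (Finset (Fin k × Fin (n + 1))) ×
      (Fin k → Fin (n + 1)) :=
    (pattern G (r t), {I | IsKernel G n (I.image (r t))}, i₀ ∘ t)
  have factors : (T.typeOf : (Fin k → V) → T.CompleteType (Fin k)).FactorsThrough data := by
    intro t s hts
    simp only [data, Prod.mk.injEq, Set.ext_iff] at hts
    obtain ⟨hpat, hker, hi⟩ := hts
    obtain ⟨e, he⟩ := (isClosedPartialIso_range hpat (hr t) (hr s) hker).exists_iso hn hG hG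
      (Set.finite_range _)
    obtain ⟨f, hf⟩ := exists_equiv_of_iso e
    have hfts : f ∘ t = s := funext fun i => by
      have hri : e (r t (i, i₀ (t i))) = r s (i, i₀ (t i)) := he _ ⟨_, rfl⟩
      simp only [r] at hri
      rwa [hi₀, show i₀ (t i) = i₀ (s i) from congr_fun hi i, hi₀, ← hf] at hri
    exact typeOf_eq_iff.2 fun φ =>
      hfts ▸ (Language.StrongHomClass.realize_formula f φ).symm
  have : Nonempty (T.CompleteType (Fin k)) := ⟨T.typeOf fun _ => Classical.arbitrary V⟩
  obtain ⟨f, hf⟩ := (Function.factorsThrough_iff _).1 factors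
  rw [Language.Theory.realizedTypes, hf, Set.range_comp]
  exact (Set.toFinite _).image f

lemma theoryOfExistentiallyComplete_eq (hn : 3 ≤ n)
    (hG : IsExistentiallyComplete (cliqueWithTriangle n) G) :
    let := G.structure
    theoryOfExistentiallyComplete.{u} (cliqueWithTriangle n) =
      Language.graph.completeTheory V := by
  intro _
  refine Set.Subset.antisymm (fun φ hφ => hφ V G hG) fun φ hφ W H hH => ?_
  let := H.structure
  obtain ⟨e⟩ := hG.nonempty_iso hn hH
  obtain ⟨f, -⟩ := exists_equiv_of_iso e
  exact (Language.StrongHomClass.realize_sentence f φ).1 hφ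

theorem isAleph0Categorical_theoryOfExistentiallyComplete (hn : 3 ≤ n) :
    IsAleph0Categorical.{u} (theoryOfExistentiallyComplete.{u} (cliqueWithTriangle n)) := by
  obtain ⟨V, G, hG⟩ := exists_isExistentiallyComplete.{u} (cliqueWithTriangle n)
  let := G.structure
  have := hG.nonempty
  have := hG.countable
  rw [theoryOfExistentiallyComplete_eq hn hG]
  have hV (M : (Language.graph.completeTheory V).ModelType) (hM : Countable M) :
      Nonempty (V ≃[Language.graph] M) :=
    nonempty_equiv_of_isComplete (Language.completeTheory.isComplete _ V)
      fun k => hG.finite_realizedTypes hn _ k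
  refine ⟨⟨Language.Theory.ModelType.of _ V, hG.countable⟩, fun M N hM hN => ?_⟩
  obtain ⟨e₁⟩ := hV M hM
  obtain ⟨e₂⟩ := hV N hN
  exact ⟨e₂.comp e₁.symm⟩

theorem exists_isUniversalFor (hn : 3 ≤ n) :
    ∃ (V : Type u) (U : SimpleGraph V), IsUniversalFor (cliqueWithTriangle n) U := by
  obtain ⟨V, U, hU⟩ := exists_isExistentiallyComplete.{u} (cliqueWithTriangle n)
  refine ⟨V, U, hU.1, fun V' G hG => ?_⟩
  obtain ⟨W, H, hH, ⟨e⟩⟩ := exists_isExistentiallyComplete_embedding hG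
  obtain ⟨f⟩ := hH.nonempty_iso hn hU
  exact ⟨f.toEmbedding.comp e⟩

end Categoricity

end UniversalGraphs

theorem lemma13 (n : ℕ) (hn : 3 ≤ n) :
    (∀ (V : Type u) (G : SimpleGraph V),
      IsExistentiallyComplete (cliqueWithTriangle n) G →
        (∀ A : Set V, A = acl G A ↔ ∀ a ∈ A, UniversalGraphs.star G n a ⊆ A) ∧
        (∀ a : V, (insert a (UniversalGraphs.star G n a)).encard ≤ (n : ℕ∞) + 1) ∧
        (∀ A : Set V, (acl G A).encard ≤ ((n : ℕ∞) + 1) * A.encard)) ∧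
    IsAleph0Categorical.{u} (theoryOfExistentiallyComplete.{u} (cliqueWithTriangle n)) ∧
    (∃ (V : Type u) (U : SimpleGraph V), IsUniversalFor (cliqueWithTriangle n) U) :=
  ⟨fun _ _ hG => ⟨fun _ => hG.eq_acl_iff hn,
      (hG.cliqueTriangleFree (by omega)).encard_insert_star_le hn, fun _ => hG.encard_acl_le hn⟩,
    isAleph0Categorical_theoryOfExistentiallyComplete hn, exists_isUniversalFor hn⟩
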